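/- Let $1\le k\le n$ be integers and $\theta\in(0,\pi/2)$. Let $\mathcal C_\theta=\{\zeta\in\mathbb R^{n+1}: |\zeta+\cos\theta\,e_{n+1}|=1,\ \langle\zeta,e_{n+1}\rangle\ge 0\}$ be the unit spherical cap meeting the hyperplane $\{x_{n+1}=0\}$ at angle $\theta$, with round metric $g$, Levi-Civita connection $\nabla$ and outward unit conormal $\mu$ along $\partial\mathcal C_\theta$. For a smooth function $f$ on $\mathcal C_\theta$ (smooth up to the boundary) put $\tau[f]=\nabla^2f+f\,g$ and $\tau^\sharp[f]=g^{-1}\tau[f]$; $f$ is called strictly convex if $\tau[f]$ is positive definite on $\mathcal C_\theta$, and even if $f(-x_1,\dots,-x_n,x_{n+1})=f(x_1,\dots,x_n,x_{n+1})$. Let $\sigma_k$ of an endomorphism denote the $k$-th elementary symmetric function of its eigenvalues. **Theorem 3.3.** Let $1<p<k+1$ and $0<\gamma<\frac{2(p-1)}{k}$, and let $\varphi$ be a positive smooth function on $\mathcal C_\theta$. Then there is a constant $C_1>0$, depending only on $n,\theta,k,p,\gamma$ and $\varphi$, such that every even, smooth, strictly convex function $s:\mathcal C_\theta\to\mathbb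 R$ with $$\sigma_k(\tau^\sharp[s])=s^{p-1}\varphi\ \text{ in }\mathcal C_\theta,\qquad \nabla_\mu s=\cot\theta\,s\ \text{ on }\partial\mathcal C_\theta$$ satisfies $$C_1^{-1}\le s\le C_1\quad\text{on }\mathcal C_\theta .$$ -/

import Mathlib

open scoped ContDiff RealInnerProductSpace

noncomputable section

namespace Capillary

/-- The ambient space `ℝ^{n+1}` with its Euclidean inner product. -/
abbrev E (n : ℕ) : Type := EuclideanSpace ℝ (Fin (n + 1))

/-- The last vector `e_{n+1}` of the standard basis. -/
def eLast (n : ℕ) : E n := EuclideanSpace.single (Fin.last n) 1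

/-- The spherical cap `S^n_θ = {x ∈ S^n : ⟨x, e_{n+1}⟩ ≥ cos θ}`. -/
def sphericalCap (n : ℕ) (θ : ℝ) : Set (E n) :=
  {x | ‖x‖ = 1 ∧ Real.cos θ ≤ ⟪x, eLast n⟫}

/-- The translated cap `C_θ = S^n_θ - cos θ e_{n+1}`. -/
def cap (n : ℕ) (θ : ℝ) : Set (E n) :=
  {ζ | ζ + Real.cos θ • eLast n ∈ sphericalCap n θ}

variable {n : ℕ} {θ : ℝ}

/-- The outer unit normal `ν(ζ) = ζ + cos θ e_{n+1}` of `C_θ`. -/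
def normal (ζ : cap n θ) : E n := (ζ : E n) + Real.cos θ • eLast n

/-- The tangent space `T_ζ C_θ = ν(ζ)^⊥`, with the round metric `g` induced from `ℝ^{n+1}`. -/
abbrev tangent (ζ : cap n θ) : Submodule ℝ (E n) := (Submodule.span ℝ {normal ζ})ᗮ

/-- The boundary `∂C_θ = C_θ ∩ {x_{n+1} = 0}`. -/
def IsBoundary (ζ : cap n θ) : Prop := ⟪(ζ : E n), eLast n⟫ = 0

/-- At a boundary point, the outward unit conormal `μ` of `∂C_θ` in `C_θ`:
for `ν = sin θ ω + cos θ e_{n+1}` with `ω` a horizontal unit vector, this is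
`μ = cos θ ω - sin θ e_{n+1}`. -/
def conormal (ζ : cap n θ) : E n :=
  (Real.sin θ)⁻¹ • (Real.cos θ • normal ζ - eLast n)

/-- `F` is a smooth extension of `f : C_θ → ℝ` to `ℝ^{n+1}`. -/
def IsSmoothExtension (f : cap n θ → ℝ) (F : E n → ℝ) : Prop :=
  ContDiff ℝ ∞ F ∧ ∀ ζ : cap n θ, F ζ = f ζ

/-- `f ∈ C^∞(C_θ)`, i.e. `f` is smooth up to the boundary of the compact cap: it is the restriction
of a smooth function on `ℝ^{n+1}`. -/
def IsSmooth (f : cap n θ → ℝ) : Prop := ∃ F : E n → ℝ, IsSmoothExtension f F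

open Classical in
/-- Some smooth extension of `f` (zero if there is none). The differential operators below do not
depend on which extension is taken; see `deriv_eq` and `hess_eq`. -/
def extend (f : cap n θ → ℝ) : E n → ℝ :=
  if h : IsSmooth f then Classical.choose h else fun _ => 0

/-- The derivative `∇_v f` at `ζ` in the direction of a tangent vector `v`. -/
def deriv (f : cap n θ → ℝ) (ζ : cap n θ) (v : E n) : ℝ :=
  fderiv ℝ (extend f) ζ v

/-- The round metric `g` on `T_ζ C_θ`. -/
def metric (ζ : cap n θ) : tangent ζ →L[ℝ] tangent ζ →L[ℝ] ℝ := innerSL ℝ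

/-- The covariant Hessian `∇²F = D²F - (∂F/∂ν) g` on `C_θ`, a portion of a unit sphere with outer
normal `ν`, of the restriction to `C_θ` of a function `F` on `ℝ^{n+1}`. -/
def ambientHess (F : E n → ℝ) (ζ : cap n θ) : tangent ζ →L[ℝ] tangent ζ →L[ℝ] ℝ :=
  (fderiv ℝ (fderiv ℝ F) (ζ : E n)).bilinearComp (tangent ζ).subtypeL (tangent ζ).subtypeL
    - (fderiv ℝ F (ζ : E n) (normal ζ)) • metric ζ

/-- The covariant Hessian `∇²f` of a smooth function `f` on `C_θ`. -/
def hess (f : cap n θ → ℝ) (ζ : cap n θ) : tangent ζ →L[ℝ] tangent ζ →L[ℝ] ℝ :=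
  ambientHess (extend f) ζ

/-- `τ[f] = ∇²f + f g`. -/
def tau (f : cap n θ → ℝ) (ζ : cap n θ) : tangent ζ →L[ℝ] tangent ζ →L[ℝ] ℝ :=
  hess f ζ + f ζ • metric ζ

/-- `τ♯[f] = g⁻¹ · τ[f]`, the endomorphism of `T_ζ C_θ` with `g(τ♯[f] X, Y) = τ[f](X, Y)`. -/
def tauSharp (f : cap n θ → ℝ) (ζ : cap n θ) : tangent ζ →ₗ[ℝ] tangent ζ where
  toFun X := (InnerProductSpace.toDual ℝ (tangent ζ)).symm (tau f ζ X)
  map_add' X Y := by simp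
  map_smul' c X := by simp

/-- `σ_k(A)`: the `k`-th elementary symmetric function of the eigenvalues of `A`, counted with
multiplicity (all of them real when `A` is symmetric). -/
def sigma {V : Type*} [AddCommGroup V] [Module ℝ V] [Module.Finite ℝ V] [Module.Free ℝ V]
    (k : ℕ) (A : V →ₗ[ℝ] V) : ℝ :=
  A.charpoly.roots.esymm k

/-- The reflection `(x_1, …, x_n, x_{n+1}) ↦ (-x_1, …, -x_n, x_{n+1})`. -/
def reflect (x : E n) : E n :=
  WithLp.toLp 2 fun i => if i = Fin.last n then x i else -x i

/-- `f` is even: `f(Rζ) = f(ζ)`. (The reflection `R` maps `C_θ` onto itself, see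
`reflect_mem_cap`.) -/
def IsEven (f : cap n θ → ℝ) : Prop :=
  ∀ ζ ξ : cap n θ, (ξ : E n) = reflect (ζ : E n) → f ξ = f ζ

/-- `f` is strictly convex: `τ[f]` is positive definite on `C_θ`, up to the boundary. -/
def IsStrictlyConvex (f : cap n θ → ℝ) : Prop :=
  ∀ (ζ : cap n θ) (X : tangent ζ), X ≠ 0 → 0 < tau f ζ X X

/-- `s` is a smooth solution of `σ_k(τ♯[s]) = s^{p-1} φ` in `C_θ`, `∇_μ s = cot θ s` on `∂C_θ`. -/
structure IsSolution (k : ℕ) (p : ℝ) (φ s : cap n θ → ℝ) : Prop where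
  smooth : IsSmooth s
  equation : ∀ ζ : cap n θ, sigma k (tauSharp s ζ) = s ζ ^ (p - 1) * φ ζ
  boundary : ∀ ζ : cap n θ, IsBoundary ζ → deriv s ζ (conormal ζ) = Real.cot θ * s ζ

/-! Checks of the definitions. -/

theorem inner_eLast (x : E n) : ⟪x, eLast n⟫ = x (Fin.last n) := by
  simp [eLast, EuclideanSpace.inner_single_right]

theorem norm_eLast : ‖eLast n‖ = 1 := by simp [eLast]

theorem norm_normal (ζ : cap n θ) : ‖normal ζ‖ = 1 := ζ.2.1

theorem mem_tangent {ζ : cap n θ} {v : E n} : v ∈ tangent ζ ↔ ⟪normal ζ, v⟫ = 0 :=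
  Submodule.mem_orthogonal_singleton_iff_inner_right

theorem metric_apply (ζ : cap n θ) (X Y : tangent ζ) : metric ζ X Y = ⟪(X : E n), (Y : E n)⟫ :=
  rfl

theorem inner_tauSharp (f : cap n θ → ℝ) (ζ : cap n θ) (X Y : tangent ζ) :
    ⟪tauSharp f ζ X, Y⟫ = tau f ζ X Y := by
  simp [tauSharp]

theorem isSmoothExtension_extend {f : cap n θ → ℝ} (hf : IsSmooth f) :
    IsSmoothExtension f (extend f) := by
  unfold extend
  rw [dif_pos hf]
  exact Classical.choose_spec hf

theorem reflect_mem_cap {x : E n} (hx : x ∈ cap n θ) : reflect x ∈ cap n θ := by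
  obtain ⟨h1, h2⟩ := hx
  have key : reflect x + Real.cos θ • eLast n = reflect (x + Real.cos θ • eLast n) := by
    ext i
    by_cases hi : i = Fin.last n <;> simp [reflect, eLast, hi]
  refine ⟨?_, ?_⟩
  · rw [key, ← h1, EuclideanSpace.norm_eq, EuclideanSpace.norm_eq]
    congr 1
    refine Finset.sum_congr rfl fun i _ => ?_
    by_cases hi : i = Fin.last n <;> simp [reflect, hi]
    ring
  · rw [key, inner_eLast]
    rw [inner_eLast] at h2
    simpa [reflect] using h2

theorem inner_normal_eLast {ζ : cap n θ} (hζ : IsBoundary ζ) :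
    ⟪normal ζ, eLast n⟫ = Real.cos θ := by
  have h : ⟪(ζ : E n), eLast n⟫ = 0 := hζ
  rw [normal, inner_add_left, h, inner_smul_left, real_inner_self_eq_norm_sq, norm_eLast]
  simp

theorem conormal_mem_tangent {ζ : cap n θ} (hζ : IsBoundary ζ) : conormal ζ ∈ tangent ζ := by
  rw [mem_tangent, conormal, inner_smul_right, inner_sub_right, inner_smul_right,
    real_inner_self_eq_norm_sq, norm_normal, inner_normal_eLast hζ]
  simp

theorem norm_conormal {ζ : cap n θ} (hζ : IsBoundary ζ) (hθ : 0 < Real.sin θ) :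
    ‖conormal ζ‖ = 1 := by
  have h : ‖Real.cos θ • normal ζ - eLast n‖ ^ 2 = Real.sin θ ^ 2 := by
    rw [norm_sub_sq_real, norm_smul, norm_normal, norm_eLast, inner_smul_left,
      inner_normal_eLast hζ]
    simp
    nlinarith [Real.sin_sq_add_cos_sq θ]
  have h' : ‖Real.cos θ • normal ζ - eLast n‖ = Real.sin θ := by
    rwa [sq_eq_sq₀ (norm_nonneg _) hθ.le] at h
  rw [conormal, norm_smul, h', norm_inv, Real.norm_of_nonneg hθ.le, inv_mul_cancel₀ hθ.ne']

/-- `μ` is orthogonal to the tangent vectors of `∂C_θ`. -/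
theorem inner_conormal (ζ : cap n θ) {v : E n} (hv : v ∈ tangent ζ) (hv' : ⟪v, eLast n⟫ = 0) :
    ⟪v, conormal ζ⟫ = 0 := by
  rw [mem_tangent, real_inner_comm] at hv
  rw [conormal, inner_smul_right, inner_sub_right, inner_smul_right, hv, hv']
  simp

/-- `μ` points out of the half-space `{x_{n+1} > 0}`. -/
theorem inner_conormal_eLast {ζ : cap n θ} (hζ : IsBoundary ζ) (hθ : 0 < Real.sin θ) :
    ⟪conormal ζ, eLast n⟫ = -Real.sin θ := by
  rw [conormal, inner_smul_left, inner_sub_left, inner_smul_left, inner_normal_eLast hζ,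
    real_inner_self_eq_norm_sq, norm_eLast]
  simp
  field_simp
  nlinarith [Real.sin_sq_add_cos_sq θ]

/-! The operators do not depend on the choice of the smooth extension. -/

theorem deriv_zero_of_right {g : ℝ → ℝ} (hg : Differentiable ℝ g)
    (h0 : ∀ᶠ t in nhdsWithin (0 : ℝ) (Set.Ioi 0), g t = 0) :
    _root_.deriv g 0 = 0 := by
  have hc : g 0 = 0 := by
    have h1 : Filter.Tendsto g (nhdsWithin (0 : ℝ) (Set.Ioi 0)) (nhds (g 0)) :=
      (hg 0).continuousAt.tendsto.mono_left nhdsWithin_le_nhds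
    have h2 : Filter.Tendsto g (nhdsWithin (0 : ℝ) (Set.Ioi 0)) (nhds 0) :=
      tendsto_const_nhds.congr' (h0.mono fun t ht => ht.symm)
    exact tendsto_nhds_unique h1 h2
  have h1 : HasDerivWithinAt g (_root_.deriv g 0) (Set.Ioi 0) 0 :=
    (hg 0).hasDerivAt.hasDerivWithinAt
  have h2 : HasDerivWithinAt g 0 (Set.Ioi 0) 0 :=
    (hasDerivWithinAt_const (0 : ℝ) (Set.Ioi 0) (0 : ℝ)).congr_of_eventuallyEq h0 hc
  exact (uniqueDiffWithinAt_Ioi (0 : ℝ)).eq_deriv _ h1 h2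

theorem second_deriv_zero_of_right {g : ℝ → ℝ} (hg' : Differentiable ℝ (_root_.deriv g))
    (h0 : ∀ᶠ t in nhdsWithin (0 : ℝ) (Set.Ioi 0), g t = 0) :
    _root_.deriv (_root_.deriv g) 0 = 0 := by
  refine deriv_zero_of_right hg' ?_
  have h1 := eventually_eventually_nhdsWithin.2 h0
  filter_upwards [h1, self_mem_nhdsWithin] with t ht htpos
  rw [IsOpen.nhdsWithin_eq isOpen_Ioi htpos] at ht
  have : g =ᶠ[nhds t] fun _ => (0 : ℝ) := ht
  rw [this.deriv_eq]
  simp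

/-- The great circle from `ζ` in the direction of the unit tangent vector `X`. -/
def circ (ζ : cap n θ) (X : E n) (t : ℝ) : E n :=
  Real.cos t • normal ζ + Real.sin t • X - Real.cos θ • eLast n

theorem circ_mem (ζ : cap n θ) {X : E n} (hX : ⟪normal ζ, X⟫ = 0) (hX1 : ‖X‖ = 1)
    (h : Real.cos θ < ⟪normal ζ, eLast n⟫ ∨ 0 < ⟪X, eLast n⟫) :
    ∀ᶠ t in nhdsWithin (0 : ℝ) (Set.Ioi 0), circ ζ X t ∈ cap n θ := by
  set a := ⟪normal ζ, eLast n⟫ with ha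
  set b := ⟪X, eLast n⟫ with hb
  have ha' : Real.cos θ ≤ a := ζ.2.2
  have hev : ∀ᶠ t in nhdsWithin (0 : ℝ) (Set.Ioi 0),
      Real.cos θ ≤ Real.cos t * a + Real.sin t * b := by
    rcases h with h | h
    · have hc : ContinuousAt (fun t => Real.cos t * a + Real.sin t * b) 0 := by fun_prop
      have := hc.eventually (lt_mem_nhds (a := Real.cos θ) (by simpa using h))
      exact nhdsWithin_le_nhds (this.mono fun t ht => ht.le)
    · have hd : HasDerivAt (fun t => Real.cos t * a + Real.sin t * b) b 0 := by
        have := ((Real.hasDerivAt_cos 0).mul_const a).add ((Real.hasDerivAt_sin 0).mul_const b)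
        simp only [Real.sin_zero, Real.cos_zero, neg_zero, zero_mul, one_mul, zero_add] at this
        exact this
      have hs := hd.hasDerivWithinAt (s := Set.Ioi 0)
      rw [hasDerivWithinAt_iff_tendsto_slope' (by simp)] at hs
      filter_upwards [hs.eventually (lt_mem_nhds h), self_mem_nhdsWithin] with t ht htpos
      have htpos' : (0 : ℝ) < t := htpos
      rw [slope_def_field, lt_div_iff₀ (by linarith)] at ht
      simp at ht
      linarith
  filter_upwards [hev] with t ht
  have e1 : circ ζ X t + Real.cos θ • eLast n = Real.cos t • normal ζ + Real.sin t • X := by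
    simp [circ]
  refine ⟨?_, ?_⟩
  · rw [e1]
    have : ‖Real.cos t • normal ζ + Real.sin t • X‖ ^ 2 = 1 := by
      rw [norm_add_sq_real, norm_smul, norm_smul, inner_smul_left, inner_smul_right, hX, hX1,
        norm_normal]
      simp
    exact (pow_eq_one_iff_of_nonneg (norm_nonneg _) two_ne_zero).1 this
  · rw [e1, inner_add_left, inner_smul_left, inner_smul_left]
    simpa using ht

theorem zero_of_unit {D : E n → ℝ} (hD : ContDiff ℝ ∞ D) (h0 : ∀ ζ : cap n θ, D ζ = 0)
    (ζ : cap n θ) {X : E n} (hX : ⟪normal ζ, X⟫ = 0) (hX1 : ‖X‖ = 1)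
    (h : Real.cos θ < ⟪normal ζ, eLast n⟫ ∨ 0 < ⟪X, eLast n⟫) :
    fderiv ℝ D ζ X = 0 ∧
      fderiv ℝ (fderiv ℝ D) ζ X X - fderiv ℝ D ζ (normal ζ) = 0 := by
  have hz : circ ζ X 0 = ζ := by simp [circ, normal]
  have hc : ∀ t, HasDerivAt (circ ζ X)
      (-Real.sin t • normal ζ + Real.cos t • X) t := fun t => by
    have := (((Real.hasDerivAt_cos t).smul_const (normal ζ)).add
      ((Real.hasDerivAt_sin t).smul_const X)).sub_const (Real.cos θ • eLast n)
    exact this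
  have hDd : Differentiable ℝ D := hD.differentiable (by simp)
  have hD2 : Differentiable ℝ (fderiv ℝ D) :=
    (hD.fderiv_right (m := 1) (by norm_cast)).differentiable (by simp)
  have hg : ∀ t, HasDerivAt (fun t => D (circ ζ X t))
      (fderiv ℝ D (circ ζ X t) (-Real.sin t • normal ζ + Real.cos t • X)) t := fun t =>
    (hDd _).hasFDerivAt.comp_hasDerivAt t (hc t)
  have hgd : _root_.deriv (fun t => D (circ ζ X t)) = fun t =>
      fderiv ℝ D (circ ζ X t) (-Real.sin t • normal ζ + Real.cos t • X) :=
    funext fun t => (hg t).deriv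
  have hw : ∀ t, HasDerivAt (fun t : ℝ => -Real.sin t • normal ζ + Real.cos t • X)
      (-Real.cos t • normal ζ + -Real.sin t • X) t := fun t =>
    ((Real.hasDerivAt_sin t).neg.smul_const (normal ζ)).add
      ((Real.hasDerivAt_cos t).smul_const X)
  have hg2 : ∀ t, HasDerivAt (fun t =>
      fderiv ℝ D (circ ζ X t) (-Real.sin t • normal ζ + Real.cos t • X))
      (fderiv ℝ (fderiv ℝ D) (circ ζ X t) (-Real.sin t • normal ζ + Real.cos t • X)
          (-Real.sin t • normal ζ + Real.cos t • X)
        + fderiv ℝ D (circ ζ X t) (-Real.cos t • normal ζ + -Real.sin t • X)) t := fun t =>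
    ((hD2 _).hasFDerivAt.comp_hasDerivAt t (hc t)).clm_apply (hw t)
  have hev : ∀ᶠ t in nhdsWithin (0 : ℝ) (Set.Ioi 0), D (circ ζ X t) = 0 :=
    (circ_mem ζ hX hX1 h).mono fun t ht => h0 ⟨_, ht⟩
  have r1 := deriv_zero_of_right (fun t => (hg t).differentiableAt) hev
  have r2 := second_deriv_zero_of_right
    (by rw [hgd]; exact fun t => (hg2 t).differentiableAt) hev
  rw [hgd] at r1 r2
  rw [(hg2 0).deriv] at r2
  simp only [hz, Real.sin_zero, Real.cos_zero, neg_zero, zero_smul, zero_add, one_smul, add_zero,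
    neg_smul, map_neg] at r1 r2
  exact ⟨r1, by linarith⟩

theorem ambientHess_apply (F : E n → ℝ) (ζ : cap n θ) (X Y : tangent ζ) :
    ambientHess F ζ X Y =
      fderiv ℝ (fderiv ℝ F) ζ X Y - fderiv ℝ F ζ (normal ζ) * ⟪(X : E n), (Y : E n)⟫ := by
  simp [ambientHess, metric_apply]

theorem zero_of_good {D : E n → ℝ} (hD : ContDiff ℝ ∞ D) (h0 : ∀ ζ : cap n θ, D ζ = 0)
    (ζ : cap n θ) (X : tangent ζ)
    (h : Real.cos θ < ⟪normal ζ, eLast n⟫ ∨ 0 < ⟪(X : E n), eLast n⟫) :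
    fderiv ℝ D ζ X = 0 ∧ ambientHess D ζ X X = 0 := by
  by_cases hX0 : (X : E n) = 0
  · have : X = 0 := Subtype.ext hX0
    subst this
    simp
  have hpos : 0 < ‖(X : E n)‖ := norm_pos_iff.2 hX0
  have hX := mem_tangent.1 X.2
  obtain ⟨h1, h2⟩ := zero_of_unit hD h0 ζ (X := ‖(X : E n)‖⁻¹ • (X : E n))
    (by rw [inner_smul_right, hX, mul_zero])
    (by rw [norm_smul, norm_inv, norm_norm, inv_mul_cancel₀ hpos.ne'])
    (h.imp id fun h => by
      rw [inner_smul_left]; exact mul_pos (by simpa using hpos) h)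
  rw [map_smul, smul_eq_mul, mul_eq_zero, inv_eq_zero] at h1
  refine ⟨h1.resolve_left hpos.ne', ?_⟩
  rw [ambientHess_apply, real_inner_self_eq_norm_sq]
  simp only [map_smul, _root_.smul_apply, smul_eq_mul] at h2
  field_simp at h2
  linarith

theorem exists_direction (hθ : 0 < Real.sin θ) (ζ : cap n θ) :
    ∃ Z : tangent ζ, ∀ X : tangent ζ, ∃ T : ℝ, ∀ t, T ≤ t →
      (Real.cos θ < ⟪normal ζ, eLast n⟫ ∨ 0 < ⟪((X + t • Z : tangent ζ) : E n), eLast n⟫) := by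
  rcases lt_or_eq_of_le (show Real.cos θ ≤ ⟪normal ζ, eLast n⟫ from ζ.2.2) with h | h
  · exact ⟨0, fun X => ⟨0, fun t _ => Or.inl h⟩⟩
  · have hZ : eLast n - Real.cos θ • normal ζ ∈ tangent ζ := by
      rw [mem_tangent, inner_sub_right, inner_smul_right, real_inner_self_eq_norm_sq, norm_normal,
        ← h]
      simp
    refine ⟨⟨_, hZ⟩, fun X => ⟨(1 - ⟪(X : E n), eLast n⟫) / Real.sin θ ^ 2, fun t ht => Or.inr ?_⟩⟩
    rw [div_le_iff₀ (by positivity)] at ht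
    have e : ⟪eLast n - Real.cos θ • normal ζ, eLast n⟫ = Real.sin θ ^ 2 := by
      rw [inner_sub_left, inner_smul_left, ← h, real_inner_self_eq_norm_sq, norm_eLast]
      simp
      nlinarith [Real.sin_sq_add_cos_sq θ]
    simp only [Submodule.coe_add, Submodule.coe_smul, inner_add_left, inner_smul_left, e]
    simp
    linarith

theorem zero_of_vanish (hθ : 0 < Real.sin θ) {D : E n → ℝ} (hD : ContDiff ℝ ∞ D)
    (h0 : ∀ ζ : cap n θ, D ζ = 0) (ζ : cap n θ) :
    (∀ X : tangent ζ, fderiv ℝ D ζ X = 0) ∧ ambientHess D ζ = 0 := by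
  obtain ⟨Z, hZ⟩ := exists_direction hθ ζ
  have key : ∀ X : tangent ζ, fderiv ℝ D ζ X = 0 ∧ ambientHess D ζ X X = 0 := by
    intro X
    obtain ⟨T, hT⟩ := hZ X
    have k1 := zero_of_good hD h0 ζ _ (hT T le_rfl)
    have k2 := zero_of_good hD h0 ζ _ (hT (T + 1) (by linarith))
    have k3 := zero_of_good hD h0 ζ _ (hT (T + 2) (by linarith))
    simp only [Submodule.coe_add, Submodule.coe_smul, map_add, map_smul, smul_eq_mul,
      _root_.add_apply, _root_.smul_apply] at k1 k2 k3
    obtain ⟨a1, b1⟩ := k1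
    obtain ⟨a2, b2⟩ := k2
    obtain ⟨a3, b3⟩ := k3
    constructor
    · linear_combination (T + 1) * a1 - T * a2
    · linear_combination ((T + 1) * (T + 2) / 2) * b1 - (T * (T + 2)) * b2
        + (T * (T + 1) / 2) * b3
  refine ⟨fun X => (key X).1, ?_⟩
  have hsymm : ∀ X Y : tangent ζ, ambientHess D ζ X Y = ambientHess D ζ Y X := fun X Y => by
    rw [ambientHess_apply, ambientHess_apply, real_inner_comm]
    congr 1
    exact (hD.contDiffAt.isSymmSndFDerivAt (by simpa using (by norm_cast : (2 : WithTop ℕ∞) ≤ ∞))).eq _ _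
  ext X Y
  have h1 := (key (X + Y)).2
  simp only [map_add, _root_.add_apply, (key X).2, (key Y).2, hsymm Y X] at h1
  change ambientHess D ζ X Y = 0
  linarith

theorem fderiv_sub_smooth {F G : E n → ℝ} (hF : ContDiff ℝ ∞ F) (hG : ContDiff ℝ ∞ G) :
    fderiv ℝ (F - G) = fderiv ℝ F - fderiv ℝ G :=
  funext fun x => fderiv_sub (hF.differentiable (by simp) x) (hG.differentiable (by simp) x)

theorem ambientHess_sub {F G : E n → ℝ} (hF : ContDiff ℝ ∞ F) (hG : ContDiff ℝ ∞ G)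
    (ζ : cap n θ) : ambientHess (F - G) ζ = ambientHess F ζ - ambientHess G ζ := by
  have h : fderiv ℝ (fderiv ℝ F - fderiv ℝ G) (ζ : E n) =
      fderiv ℝ (fderiv ℝ F) ζ - fderiv ℝ (fderiv ℝ G) ζ :=
    fderiv_sub ((hF.fderiv_right (m := 1) (by norm_cast)).differentiable (by simp) _)
      ((hG.fderiv_right (m := 1) (by norm_cast)).differentiable (by simp) _)
  ext X Y
  simp only [ambientHess_apply, _root_.sub_apply, fderiv_sub_smooth hF hG, h,
    Pi.sub_apply]
  ring

/-- The tangential derivative of `f` may be computed from any smooth extension. -/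
theorem deriv_eq (hθ : 0 < Real.sin θ) {f : cap n θ → ℝ} {F : E n → ℝ}
    (hF : IsSmoothExtension f F) (ζ : cap n θ) (X : tangent ζ) :
    deriv f ζ X = fderiv ℝ F ζ X := by
  have hG := isSmoothExtension_extend ⟨F, hF⟩
  have h := (zero_of_vanish hθ (hG.1.sub hF.1) (fun ξ => by simp [hG.2, hF.2]) ζ).1 X
  have h' := fderiv_sub_smooth hG.1 hF.1
  change fderiv ℝ (extend f - F) _ _ = 0 at h
  rw [h'] at h
  simpa [deriv, sub_eq_zero] using h

/-- The covariant Hessian of `f` may be computed from any smooth extension. -/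
theorem hess_eq (hθ : 0 < Real.sin θ) {f : cap n θ → ℝ} {F : E n → ℝ}
    (hF : IsSmoothExtension f F) (ζ : cap n θ) : hess f ζ = ambientHess F ζ := by
  have hG := isSmoothExtension_extend ⟨F, hF⟩
  have h := (zero_of_vanish hθ (hG.1.sub hF.1) (fun ξ => by simp [hG.2, hF.2]) ζ).2
  have h' := ambientHess_sub hG.1 hF.1 ζ
  change ambientHess (extend f - F) _ = 0 at h
  rw [h'] at h
  exact sub_eq_zero.1 h

end Capillary

end

/-!
Let `H` be the extension of `s` to the ambient space that is homogeneous of degree one: `s` is its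
restriction to the unit sphere, `τ[s]` is the restriction of `D²H` to the tangent spaces, and the
Robin condition says that `∂H/∂x_{n+1} = 0` over the boundary. All derivatives are thus those of a
function on a Euclidean space, and the maximum principle is applied along great circles of the unit
sphere.

* Extrema. A minimum of `s` is interior, because `s` decreases inwards at the boundary, and there
  `τ[s] ≥ s g`, whence `s ^ k ≤ s ^ (p - 1) φ` and `min s` is bounded above, as `p - 1 < k`. In the
  same way, at a maximum of `s exp(λ ⟨ν, e⟩)` one has `τ[s] ≤ C s g`, so that `max s` is bounded
  below (`exists_min_le`, `exists_le_max`).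
* Gradient estimate. Let `ℓ` be the support function of the cap and `W = ℓ ∇(s / ℓ)`. The function
  `|W| / s ^ h`, where `0 < h < (p - 1) / k` and `h < 1`, increases inwards at the boundary, because
  `|W|` has vanishing normal derivative there while `s` decreases. At an interior maximum the
  second-order condition, traced with `∂σ_k/∂τ`, and the differentiated equation bound `|W|` by a
  multiple of `s` (`norm_quotientGradient_le_of_max`); the factor `s ^ (p - 1)` of the
  equation contributes the coefficient `p - 1 - h k > 0`. Hence
  `|W| ≤ C (max s) ^ (1 - h) s ^ h` (`gradient_estimate`).
* Harnack inequality. Along a meridian `g'' + g > 0`, `g' = 0` at the pole by evenness, and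
  `g' = cot θ g` at the boundary. By Sturm comparison `g / cos` increases and `g / sin` decreases
  (`sturm_comparison`). So `s` is positive, is smallest near the pole up to a factor, and grows at
  least linearly away from the pole, at the rate `max s`. The gradient estimate, integrated along
  the meridian, makes the growth slower than linear if the value at the pole is small compared to
  `max s`. Therefore `max s ≤ C min s` (`le_mul_of_growth`).

With the bounds for the extrema, this gives the theorem.
-/

open scoped ContDiff RealInnerProductSpace Topology Polynomial
open Filter

noncomputable section

namespace Capillary

/-! ### Elementary symmetric functions of a symmetric operator -/

/-- Each coefficient of a polynomial of bounded degree is a fixed linear combination of values of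
the polynomial. -/
theorem exists_coeff_eq_sum_eval (N j : ℕ) :
    ∃ a : Fin (N + 1) → ℝ, ∀ P : ℝ[X], P.natDegree ≤ N →
      P.coeff j = ∑ i, a i * P.eval (i : ℝ) := by
  classical
  refine ⟨fun i => (Lagrange.basis Finset.univ (fun i : Fin (N + 1) => (i : ℝ)) i).coeff j,
    fun P hP => ?_⟩
  have hinj : Set.InjOn (fun i : Fin (N + 1) => ((i : ℕ) : ℝ))
      ((Finset.univ : Finset (Fin (N + 1))) : Set (Fin (N + 1))) := by
    intro x _ y _ hxy
    exact Fin.ext (Nat.cast_injective (R := ℝ) hxy)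
  have hdeg : P.degree < (Finset.univ : Finset (Fin (N + 1))).card := by
    rw [Finset.card_univ, Fintype.card_fin]
    exact lt_of_le_of_lt Polynomial.degree_le_natDegree (by exact_mod_cast Nat.lt_succ_of_le hP)
  conv_lhs => rw [Lagrange.eq_interpolate hinj hdeg]
  simp [Lagrange.interpolate_apply, Polynomial.finsetSum_coeff, mul_comm]

theorem hasDerivAt_det_of_eq_diagonal {ι : Type*} [Fintype ι] [DecidableEq ι]
    {M : ℝ → Matrix ι ι ℝ} {M' : Matrix ι ι ℝ} {d : ι → ℝ} {t₀ : ℝ}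
    (h : ∀ i j, HasDerivAt (fun t => M t i j) (M' i j) t₀) (h0 : M t₀ = Matrix.diagonal d) :
    HasDerivAt (fun t => (M t).det) (∑ i, M' i i * ∏ j ∈ Finset.univ.erase i, d j) t₀ := by
  simp only [Matrix.det_apply]
  have key : ∀ σ : Equiv.Perm ι, HasDerivAt (fun t => Equiv.Perm.sign σ • ∏ i, M t (σ i) i)
      (Equiv.Perm.sign σ • ∑ i, (∏ j ∈ Finset.univ.erase i, M t₀ (σ j) j) • M' (σ i) i) t₀ :=
    fun σ => by
      have := HasDerivAt.fun_finsetProd (u := Finset.univ) (fun i _ => h (σ i) i)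
      simpa [Units.smul_def] using this.const_mul (((Equiv.Perm.sign σ : ℤˣ) : ℤ) : ℝ)
  have hs := HasDerivAt.fun_sum (u := Finset.univ) (fun σ _ => key σ)
  refine hs.congr_deriv ?_
  rw [Finset.sum_eq_single 1]
  · simp only [Equiv.Perm.sign_one, one_smul, Equiv.Perm.coe_one, id, h0, smul_eq_mul,
      Matrix.diagonal_apply_eq, mul_comm]
  · -- A permutation other than the identity moves at least two indices.
    intro σ _ hσ
    rw [Finset.sum_eq_zero, smul_zero]
    intro i _
    obtain ⟨j, hj, hji⟩ : ∃ j, σ j ≠ j ∧ j ≠ i := by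
      by_contra! hcon
      apply hσ
      have hfix : ∀ j, j ≠ i → σ j = j := fun j hj => by
        by_contra h'
        exact hj (hcon j h')
      ext j
      by_cases hj : j = i
      · subst hj
        by_contra h'
        have := hfix (σ j) (by simpa using h')
        exact h' (σ.injective this)
      · simp [hfix j hj]
    rw [Finset.prod_eq_zero (Finset.mem_erase.2 ⟨hji, Finset.mem_univ j⟩), zero_smul]
    rw [h0, Matrix.diagonal_apply_ne _ hj]
  · simp

theorem hasDerivAt_charpoly_coeff {ι : Type*} [Fintype ι] [DecidableEq ι]
    {M : ℝ → Matrix ι ι ℝ} {M' : Matrix ι ι ℝ} {d : ι → ℝ} {t₀ : ℝ}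
    (h : ∀ i j, HasDerivAt (fun t => M t i j) (M' i j) t₀) (h0 : M t₀ = Matrix.diagonal d)
    (j : ℕ) :
    HasDerivAt (fun t => (M t).charpoly.coeff j)
      (-∑ i, M' i i * (∏ l ∈ Finset.univ.erase i, (Polynomial.X - Polynomial.C (d l))).coeff j)
      t₀ := by
  obtain ⟨a, ha⟩ := exists_coeff_eq_sum_eval (Fintype.card ι) j
  have h1 : ∀ t, (M t).charpoly.coeff j = ∑ i, a i * (M t).charpoly.eval (i : ℝ) := fun t =>
    ha _ (Matrix.charpoly_natDegree_eq_dim _).le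
  have h2 : ∀ i, (∏ l ∈ Finset.univ.erase i, (Polynomial.X - Polynomial.C (d l))).coeff j
      = ∑ m, a m * ∏ l ∈ Finset.univ.erase i, ((m : ℕ) - d l) := fun i => by
    rw [ha]
    · simp [Polynomial.eval_prod]
    · rw [Polynomial.natDegree_prod_of_monic _ _ fun l _ => Polynomial.monic_X_sub_C _]
      simp
  simp only [h1, h2]
  have h3 : ∀ x : ℝ, HasDerivAt (fun t => (M t).charpoly.eval x)
      (∑ i, -M' i i * ∏ l ∈ Finset.univ.erase i, (x - d l)) t₀ := fun x => by
    simp only [Matrix.eval_charpoly]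
    refine hasDerivAt_det_of_eq_diagonal (M' := -M') (fun i l => ?_) ?_
    · simpa using (h i l).const_sub (Matrix.scalar ι x i l)
    · rw [h0]
      ext i l
      by_cases hil : i = l <;> simp [hil]
  have h4 := HasDerivAt.fun_sum (u := Finset.univ)
    (fun (i : Fin (Fintype.card ι + 1)) _ => (h3 (i : ℕ)).const_mul (a i))
  refine h4.congr_deriv ?_
  simp only [Finset.mul_sum, neg_mul, mul_neg, Finset.sum_neg_distrib]
  rw [Finset.sum_comm]
  refine congrArg _ (Finset.sum_congr rfl fun _ _ => Finset.sum_congr rfl fun _ _ => ?_)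
  ring

section SigmaPartial

variable {ι : Type*} [Fintype ι] [DecidableEq ι]

/-- The partial derivative `∂σ_k/∂λ_i`, the elementary symmetric function of degree `k - 1` of the
numbers `λ_l` with `l ≠ i`, written as a coefficient of `∏_{l ≠ i} (X - λ_l)`. -/
def sigmaPartial (k : ℕ) (d : ι → ℝ) (i : ι) : ℝ :=
  (-1) ^ (k - 1) *
    (∏ l ∈ Finset.univ.erase i, (Polynomial.X - Polynomial.C (d l))).coeff (Fintype.card ι - k)

theorem esymm_nonneg {s : Multiset ℝ} (hs : ∀ x ∈ s, 0 ≤ x) (k : ℕ) : 0 ≤ s.esymm k := by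
  unfold Multiset.esymm
  refine Multiset.sum_nonneg fun y hy => ?_
  obtain ⟨t, ht, rfl⟩ := Multiset.mem_map.1 hy
  exact Multiset.prod_nonneg fun a ha =>
    hs a (Multiset.mem_of_le (Multiset.mem_powersetCard.1 ht).1 ha)

theorem sigmaPartial_nonneg {k : ℕ} (hk : 1 ≤ k) (hkn : k ≤ Fintype.card ι) {d : ι → ℝ}
    (hd : ∀ i, 0 ≤ d i) (i : ι) : 0 ≤ sigmaPartial k d i := by
  have hcard : ((Finset.univ.erase i).val.map d).card = Fintype.card ι - 1 := by
    rw [Multiset.card_map, Finset.card_val, Finset.card_erase_of_mem (Finset.mem_univ i),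
      Finset.card_univ]
  have e : (∏ l ∈ Finset.univ.erase i, (Polynomial.X - Polynomial.C (d l))) =
      (((Finset.univ.erase i).val.map d).map fun x => Polynomial.X - Polynomial.C x).prod := by
    rw [Multiset.map_map]; rfl
  rw [sigmaPartial, e, Multiset.prod_X_sub_C_coeff _ (by rw [hcard]; omega), hcard,
    show Fintype.card ι - 1 - (Fintype.card ι - k) = k - 1 by omega, ← mul_assoc, ← mul_pow]
  simp only [mul_neg, mul_one, neg_neg, one_pow, one_mul]
  refine esymm_nonneg (fun x hx => ?_) _
  obtain ⟨l, _, rfl⟩ := Multiset.mem_map.1 hx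
  exact hd l

/-- Euler's identity for the homogeneous polynomial `σ_k`. -/
theorem sum_sigmaPartial_mul {k : ℕ} (hk : 1 ≤ k) (hkn : k ≤ Fintype.card ι) (d : ι → ℝ) :
    ∑ i, sigmaPartial k d i * d i =
      k * ((-1) ^ k *
        (∏ i, (Polynomial.X - Polynomial.C (d i))).coeff (Fintype.card ι - k)) := by
  set P : ℝ[X] := ∏ i, (Polynomial.X - Polynomial.C (d i)) with hP
  set Q : ι → ℝ[X] := fun i =>
    ∏ l ∈ Finset.univ.erase i, (Polynomial.X - Polynomial.C (d l)) with hQ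
  have h1 : ∀ i, (Polynomial.X - Polynomial.C (d i)) * Q i = P := fun i =>
    Finset.mul_prod_erase _ _ (Finset.mem_univ i)
  have h2 : Polynomial.derivative P = ∑ i, Q i := by
    rw [hP, Polynomial.derivative_prod_finset]
    simp [hQ]
  have h3 : ∑ i, Polynomial.C (d i) * Q i =
      Polynomial.X * Polynomial.derivative P - Polynomial.C (Fintype.card ι : ℝ) * P := by
    rw [h2, Finset.mul_sum]
    have : ∑ i : ι, P = Polynomial.C (Fintype.card ι : ℝ) * P := by simp
    rw [← this, ← Finset.sum_sub_distrib]
    refine Finset.sum_congr rfl fun i _ => ?_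
    rw [← h1 i]
    ring
  have h4 := congrArg (fun R => Polynomial.coeff R (Fintype.card ι - k)) h3
  have h5 : (Polynomial.X * Polynomial.derivative P).coeff (Fintype.card ι - k) =
      ((Fintype.card ι : ℝ) - k) * P.coeff (Fintype.card ι - k) := by
    rcases Nat.eq_zero_or_pos (Fintype.card ι - k) with h0 | hpos
    · have : Fintype.card ι = k := by omega
      simp [this]
    · obtain ⟨m, hm⟩ : ∃ m, Fintype.card ι - k = m + 1 := ⟨_, (Nat.succ_pred_eq_of_pos hpos).symm⟩
      have : (Fintype.card ι : ℝ) = m + 1 + k := by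
        have : Fintype.card ι = m + 1 + k := by omega
        exact_mod_cast this
      rw [hm, Polynomial.coeff_X_mul, Polynomial.coeff_derivative, this]
      ring
  simp only [Polynomial.finsetSum_coeff, Polynomial.coeff_C_mul, Polynomial.coeff_sub, h5]
    at h4
  have h6 : ∑ i, sigmaPartial k d i * d i =
      (-1) ^ (k - 1) * ∑ i, d i * (Q i).coeff (Fintype.card ι - k) := by
    rw [Finset.mul_sum]
    refine Finset.sum_congr rfl fun i _ => ?_
    rw [sigmaPartial]
    ring
  rw [h6, h4]
  obtain ⟨m, rfl⟩ : ∃ m, k = m + 1 := ⟨k - 1, by omega⟩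
  simp only [Nat.add_sub_cancel, pow_succ]
  ring

end SigmaPartial

theorem le_esymm_of_le {s : Multiset ℝ} {m : ℝ} (hm : 0 ≤ m) (hs : ∀ x ∈ s, m ≤ x) {k : ℕ}
    (hk : k ≤ s.card) : m ^ k ≤ s.esymm k := by
  obtain ⟨t, ht⟩ : ∃ t, t ∈ s.powersetCard k := by
    refine Multiset.card_pos_iff_exists_mem.1 ?_
    rw [Multiset.card_powersetCard]
    exact Nat.choose_pos hk
  have hnn : ∀ u ∈ s.powersetCard k, 0 ≤ u.prod := fun u hu =>
    Multiset.prod_nonneg fun a ha =>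
      hm.trans (hs a (Multiset.mem_of_le (Multiset.mem_powersetCard.1 hu).1 ha))
  have hle : m ^ k ≤ t.prod := by
    obtain ⟨hts, hc⟩ := Multiset.mem_powersetCard.1 ht
    have := Multiset.prod_map_le_prod_map₀ (s := t) (fun _ => m) id (fun _ _ => hm)
      (fun x hx => hs x (Multiset.mem_of_le hts hx))
    simpa [hc] using this
  refine hle.trans ?_
  unfold Multiset.esymm
  refine Multiset.single_le_sum (fun y hy => ?_) _ (Multiset.mem_map_of_mem _ ht)
  obtain ⟨u, hu, rfl⟩ := Multiset.mem_map.1 hy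
  exact hnn u hu

theorem esymm_le_of_le {s : Multiset ℝ} {c : ℝ} (hs : ∀ x ∈ s, 0 ≤ x ∧ x ≤ c) (k : ℕ) :
    s.esymm k ≤ (s.card.choose k : ℝ) * c ^ k := by
  unfold Multiset.esymm
  have h := Multiset.sum_le_card_nsmul ((s.powersetCard k).map Multiset.prod) (c ^ k)
    (fun y hy => by
      obtain ⟨t, ht, rfl⟩ := Multiset.mem_map.1 hy
      obtain ⟨hts, hc⟩ := Multiset.mem_powersetCard.1 ht
      have := Multiset.prod_map_le_prod_map₀ (s := t) id (fun _ => c)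
        (fun x hx => (hs x (Multiset.mem_of_le hts hx)).1)
        (fun x hx => (hs x (Multiset.mem_of_le hts hx)).2)
      simpa [hc] using this)
  rwa [Multiset.card_map, Multiset.card_powersetCard, nsmul_eq_mul] at h

variable {n : ℕ} {θ : ℝ}

/-! ### Operators on a tangent space and on the ambient space -/

theorem sigma_eq_coeff {V : Type*} [NormedAddCommGroup V] [InnerProductSpace ℝ V]
    [FiniteDimensional ℝ V] {T : V →ₗ[ℝ] V} (hT : T.IsSymmetric) {m k : ℕ}
    (hm : Module.finrank ℝ V = m) (hk : k ≤ m) :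
    sigma k T = (-1) ^ k * T.charpoly.coeff (m - k) := by
  have hcard : (T.charpoly.roots).card = m := by
    rw [hT.roots_charpoly_eq_eigenvalues hm]; simp
  have hprod : T.charpoly = (T.charpoly.roots.map fun x => Polynomial.X - Polynomial.C x).prod := by
    rw [hT.roots_charpoly_eq_eigenvalues hm, Multiset.map_map, hT.charpoly_eq hm]
    rfl
  rw [hprod, Multiset.prod_X_sub_C_coeff _ (by rw [hcard]; omega), hcard,
    show m - (m - k) = k by omega, ← mul_assoc, ← mul_pow]
  simp [sigma]

/-- If the quadratic form of a symmetric operator is at least `c ≥ 0` times the metric, then its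
`σ_k` is at least `c ^ k`. -/
theorem pow_le_sigma {V : Type*} [NormedAddCommGroup V] [InnerProductSpace ℝ V]
    [FiniteDimensional ℝ V] {T : V →ₗ[ℝ] V} (hT : T.IsSymmetric) {c : ℝ} (hc : 0 ≤ c)
    (h : ∀ x : V, ‖x‖ = 1 → c ≤ ⟪T x, x⟫) {k : ℕ} (hk : k ≤ Module.finrank ℝ V) :
    c ^ k ≤ sigma k T := by
  refine le_esymm_of_le hc (fun x hx => ?_) ?_
  · rw [hT.roots_charpoly_eq_eigenvalues rfl] at hx
    obtain ⟨i, _, rfl⟩ := Multiset.mem_map.1 hx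
    have h1 := h (hT.eigenvectorBasis rfl i) ((hT.eigenvectorBasis rfl).orthonormal.1 i)
    rw [hT.apply_eigenvectorBasis, inner_smul_left, real_inner_self_eq_norm_sq,
      (hT.eigenvectorBasis rfl).orthonormal.1 i] at h1
    simpa using h1
  · rw [hT.roots_charpoly_eq_eigenvalues rfl]; simpa using hk

/-- If the quadratic form of a symmetric operator lies between `0` and `c` times the metric, then
its `σ_k` is at most a binomial coefficient times `c ^ k`. -/
theorem sigma_le_pow {V : Type*} [NormedAddCommGroup V] [InnerProductSpace ℝ V]
    [FiniteDimensional ℝ V] {T : V →ₗ[ℝ] V} (hT : T.IsSymmetric) {c : ℝ}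
    (h : ∀ x : V, ‖x‖ = 1 → 0 ≤ ⟪T x, x⟫ ∧ ⟪T x, x⟫ ≤ c) (k : ℕ) :
    sigma k T ≤ ((Module.finrank ℝ V).choose k : ℝ) * c ^ k := by
  have hcard : (T.charpoly.roots).card = Module.finrank ℝ V := by
    rw [hT.roots_charpoly_eq_eigenvalues rfl]; simp
  rw [← hcard]
  refine esymm_le_of_le (fun x hx => ?_) k
  rw [hT.roots_charpoly_eq_eigenvalues rfl] at hx
  obtain ⟨i, _, rfl⟩ := Multiset.mem_map.1 hx
  have h1 := h (hT.eigenvectorBasis rfl i) ((hT.eigenvectorBasis rfl).orthonormal.1 i)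
  rw [hT.apply_eigenvectorBasis, inner_smul_left, real_inner_self_eq_norm_sq,
    (hT.eigenvectorBasis rfl).orthonormal.1 i] at h1
  simpa using h1

theorem finrank_tangent (ζ : cap n θ) : Module.finrank ℝ (tangent ζ) = n := by
  have : Fact (Module.finrank ℝ (E n) = n + 1) := ⟨by simp⟩
  refine Submodule.finrank_orthogonal_span_singleton (𝕜 := ℝ) (v := normal ζ) ?_
  rw [← norm_pos_iff, norm_normal]
  exact one_pos

theorem exists_orthonormalBasis_option (ζ : cap n θ) (b : OrthonormalBasis (Fin n) ℝ (tangent ζ)) :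
    ∃ B : OrthonormalBasis (Option (Fin n)) ℝ (E n),
      B none = normal ζ ∧ ∀ i, B (some i) = b i := by
  set v : Option (Fin n) → E n := fun o => o.elim (normal ζ) fun i => b i with hv
  have hon : Orthonormal ℝ v := by
    have hperp : ∀ i, ⟪normal ζ, (b i : E n)⟫ = 0 := fun i => mem_tangent.1 (b i).2
    have hb := b.orthonormal
    rw [orthonormal_iff_ite] at hb ⊢
    rintro (_ | i) (_ | j)
    · simp [hv, norm_normal]
    · simpa [hv] using hperp j
    · simpa [hv, real_inner_comm] using hperp i
    · simpa [hv] using hb i j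
  have hcard : Fintype.card (Option (Fin n)) = Module.finrank ℝ (E n) := by simp
  have hspan : ⊤ ≤ Submodule.span ℝ (Set.range v) := by
    have := (basisOfOrthonormalOfCardEqFinrank hon hcard).span_eq
    rw [coe_basisOfOrthonormalOfCardEqFinrank] at this
    exact this.ge
  exact ⟨OrthonormalBasis.mk hon hspan, by simp [hv], fun i => by simp [hv]⟩

/-- The endomorphism of the ambient space representing a bilinear form. -/
def toOperator (Q : E n →L[ℝ] E n →L[ℝ] ℝ) : E n →ₗ[ℝ] E n where
  toFun x := (InnerProductSpace.toDual ℝ (E n)).symm (Q x)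
  map_add' x y := by simp
  map_smul' c x := by simp

theorem inner_toOperator (Q : E n →L[ℝ] E n →L[ℝ] ℝ) (x y : E n) :
    ⟪toOperator Q x, y⟫ = Q x y := by
  simp [toOperator]

theorem toMatrix_toOperator {ι : Type*} [Fintype ι] [DecidableEq ι] (B : OrthonormalBasis ι ℝ (E n))
    (Q : E n →L[ℝ] E n →L[ℝ] ℝ) (i j : ι) :
    LinearMap.toMatrix B.toBasis B.toBasis (toOperator Q) i j = Q (B j) (B i) := by
  rw [LinearMap.toMatrix_apply, OrthonormalBasis.coe_toBasis,
    OrthonormalBasis.coe_toBasis_repr_apply, OrthonormalBasis.repr_apply_apply, real_inner_comm,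
    inner_toOperator]

/-- An orthonormal frame at `ζ` made of `ν(ζ)` and of tangent vectors diagonalising a symmetric form
that has `ν(ζ)` in its kernel and represents `T` on the tangent space. -/
theorem exists_frame (ζ : cap n θ) {Q : E n →L[ℝ] E n →L[ℝ] ℝ} (hQ : ∀ x y, Q x y = Q y x)
    (hν : Q (normal ζ) = 0) {T : tangent ζ →ₗ[ℝ] tangent ζ}
    (hT : ∀ X Y : tangent ζ, ⟪T X, Y⟫ = Q X Y) :
    ∃ (B : OrthonormalBasis (Option (Fin n)) ℝ (E n)) (d : Fin n → ℝ),
      B none = normal ζ ∧ (∀ i, B (some i) ∈ tangent ζ) ∧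
      (∀ o o', Q (B o) (B o') = if o = o' then o.elim 0 d else 0) ∧
      T.charpoly = ∏ i, (Polynomial.X - Polynomial.C (d i)) := by
  have hsym : T.IsSymmetric := fun X Y => by
    rw [hT, real_inner_comm, hT, hQ]
  have hn := finrank_tangent ζ
  obtain ⟨B, hB0, hB⟩ := exists_orthonormalBasis_option ζ (hsym.eigenvectorBasis hn)
  refine ⟨B, hsym.eigenvalues hn, hB0, fun i => by rw [hB]; exact Subtype.property _, ?_, ?_⟩
  · have hon := (hsym.eigenvectorBasis hn).orthonormal
    rw [orthonormal_iff_ite] at hon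
    rintro (_ | i) (_ | j)
    · simp [hB0, hν]
    · simp [hB0, hν]
    · rw [hB0, hQ, hν]; simp
    · rw [hB, hB, ← hT, hsym.apply_eigenvectorBasis, inner_smul_left, hon]
      by_cases h : i = j <;> simp [h]
  · exact hsym.charpoly_eq hn

theorem charpoly_toOperator (ζ : cap n θ) {Q : E n →L[ℝ] E n →L[ℝ] ℝ}
    (hQ : ∀ x y, Q x y = Q y x) (hν : Q (normal ζ) = 0) {T : tangent ζ →ₗ[ℝ] tangent ζ}
    (hT : ∀ X Y : tangent ζ, ⟪T X, Y⟫ = Q X Y) :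
    (toOperator Q).charpoly = Polynomial.X * T.charpoly := by
  obtain ⟨B, d, -, -, hd, hc⟩ := exists_frame ζ hQ hν hT
  have h1 : LinearMap.toMatrix B.toBasis B.toBasis (toOperator Q) =
      Matrix.diagonal fun o : Option (Fin n) => o.elim 0 d := by
    ext o o'
    rw [toMatrix_toOperator, hd, Matrix.diagonal_apply]
    by_cases h : o = o' <;> simp [h, eq_comm]
  rw [← LinearMap.charpoly_toMatrix _ B.toBasis, h1, Matrix.charpoly_diagonal, hc,
    Fintype.prod_option]
  simp

theorem sigma_eq_coeff_toOperator (ζ : cap n θ) {Q : E n →L[ℝ] E n →L[ℝ] ℝ}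
    (hQ : ∀ x y, Q x y = Q y x) (hν : Q (normal ζ) = 0) {T : tangent ζ →ₗ[ℝ] tangent ζ}
    (hT : ∀ X Y : tangent ζ, ⟪T X, Y⟫ = Q X Y) {k : ℕ} (hk : k ≤ n) :
    sigma k T = (-1) ^ k * (toOperator Q).charpoly.coeff (n + 1 - k) := by
  have hsym : T.IsSymmetric := fun X Y => by
    rw [hT, real_inner_comm, hT, hQ]
  rw [sigma_eq_coeff hsym (finrank_tangent ζ) hk, charpoly_toOperator ζ hQ hν hT,
    show n + 1 - k = n - k + 1 by omega, Polynomial.coeff_X_mul]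

/-- The derivative of `σ_k` along a curve of forms, at a form that is diagonal in the frame `B` and
has `B none` in its kernel. -/
theorem hasDerivAt_sigma {A : ℝ → E n →L[ℝ] E n →L[ℝ] ℝ} {A' : E n →L[ℝ] E n →L[ℝ] ℝ}
    {B : OrthonormalBasis (Option (Fin n)) ℝ (E n)} {d : Fin n → ℝ}
    (hA : ∀ x y, HasDerivAt (fun t => A t x y) (A' x y) 0)
    (h0 : ∀ o o', A 0 (B o) (B o') = if o = o' then o.elim 0 d else 0)
    (hnone : A' (B none) (B none) = 0) {k : ℕ} (hk : 1 ≤ k) (hkn : k ≤ n) :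
    HasDerivAt (fun t => (-1) ^ k * (toOperator (A t)).charpoly.coeff (n + 1 - k))
      (∑ i, sigmaPartial k d i * A' (B (some i)) (B (some i))) 0 := by
  have h1 := (hasDerivAt_charpoly_coeff
    (M := fun t => LinearMap.toMatrix B.toBasis B.toBasis (toOperator (A t)))
    (M' := fun o o' => A' (B o') (B o)) (d := fun o : Option (Fin n) => o.elim 0 d) (t₀ := 0)
    (fun o o' => by simpa only [toMatrix_toOperator] using hA (B o') (B o))
    (by
      ext o o'
      rw [toMatrix_toOperator, h0, Matrix.diagonal_apply]
      by_cases h : o = o' <;> simp [h, eq_comm]) (n + 1 - k)).const_mul ((-1 : ℝ) ^ k)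
  simp only [LinearMap.charpoly_toMatrix] at h1
  refine h1.congr_deriv ?_
  rw [Fintype.sum_option, hnone, zero_mul, zero_add, mul_neg, ← neg_mul, Finset.mul_sum]
  refine Finset.sum_congr rfl fun i _ => ?_
  have h2 : (∏ l ∈ Finset.univ.erase (some i),
      (Polynomial.X - Polynomial.C ((l : Option (Fin n)).elim 0 d))) =
      Polynomial.X * ∏ l ∈ Finset.univ.erase i, (Polynomial.X - Polynomial.C (d l)) := by
    have h3 : (Finset.univ.erase (some i) : Finset (Option (Fin n))) =
        Finset.insertNone (Finset.univ.erase i) := by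
      ext (_ | l) <;> simp
    rw [h3, Finset.prod_insertNone]
    simp
  rw [h2, show n + 1 - k = n - k + 1 by omega, Polynomial.coeff_X_mul, sigmaPartial,
    Fintype.card_fin]
  obtain ⟨m, rfl⟩ : ∃ m, k = m + 1 := ⟨k - 1, by omega⟩
  simp only [Nat.add_sub_cancel, pow_succ]
  ring

/-! ### The homogeneous extension of a function on the cap -/

/-- A smooth positive function on the ambient space that equals the norm where `1 / 2 ≤ ‖z‖ ^ 2`. -/
def smoothNorm (z : E n) : ℝ :=
  Real.sqrt (‖z‖ ^ 2 + (1 - Real.smoothTransition (2 * ‖z‖ ^ 2)))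

theorem smoothNorm_radicand_pos (z : E n) :
    0 < ‖z‖ ^ 2 + (1 - Real.smoothTransition (2 * ‖z‖ ^ 2)) := by
  have h1 := Real.smoothTransition.le_one (2 * ‖z‖ ^ 2)
  rcases eq_or_ne z 0 with rfl | hz
  · simp
  · have : 0 < ‖z‖ := norm_pos_iff.2 hz
    nlinarith [pow_pos this 2]

theorem smoothNorm_pos (z : E n) : 0 < smoothNorm z := Real.sqrt_pos.2 (smoothNorm_radicand_pos z)

theorem smoothNorm_eq_norm {z : E n} (hz : 1 / 2 ≤ ‖z‖ ^ 2) : smoothNorm z = ‖z‖ := by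
  rw [smoothNorm, Real.smoothTransition.one_of_one_le (by linarith)]
  simp

theorem contDiff_smoothNorm : ContDiff ℝ ∞ (smoothNorm : E n → ℝ) := by
  refine ContDiff.sqrt ?_ fun z => (smoothNorm_radicand_pos z).ne'
  refine (contDiff_norm_sq ℝ).add (contDiff_const.sub ?_)
  exact Real.smoothTransition.contDiff.comp (contDiff_const.mul (contDiff_norm_sq ℝ))

/-- `H` is a smooth function on the ambient space which, on a neighbourhood of the unit sphere, is
the homogeneous function of degree one whose value at the normal `ν(ζ)` is `s ζ`. When `s` is a
support function, so is `H`. -/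
structure IsHomogeneousExtension (s : cap n θ → ℝ) (H : E n → ℝ) : Prop where
  contDiff : ContDiff ℝ ∞ H
  homogeneous : ∀ z, 1 / 2 ≤ ‖z‖ ^ 2 → H z = ‖z‖ * H (‖z‖⁻¹ • z)
  eq : ∀ ζ, H (normal ζ) = s ζ

theorem exists_homogeneousExtension {s : cap n θ → ℝ} (hs : IsSmooth s) :
    ∃ H, IsHomogeneousExtension s H := by
  obtain ⟨F, hF, hFs⟩ := hs
  refine ⟨fun z => smoothNorm z * F ((smoothNorm z)⁻¹ • z - Real.cos θ • eLast n), ?_, ?_, ?_⟩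
  · refine contDiff_smoothNorm.mul (hF.comp ?_)
    exact ((contDiff_smoothNorm.inv fun z => (smoothNorm_pos z).ne').smul contDiff_id).sub
      contDiff_const
  · intro z hz
    have hz0 : ‖z‖ ≠ 0 := by
      intro h
      rw [h] at hz
      norm_num at hz
    have h1 : ‖‖z‖⁻¹ • z‖ = 1 := by rw [norm_smul, norm_inv, norm_norm, inv_mul_cancel₀ hz0]
    have h2 : smoothNorm (‖z‖⁻¹ • z) = 1 := by
      rw [smoothNorm_eq_norm (by rw [h1]; norm_num), h1]
    simp only [smoothNorm_eq_norm hz, h2, inv_one, one_smul, one_mul]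
  · intro ζ
    have h2 : smoothNorm (normal ζ) = 1 := by
      rw [smoothNorm_eq_norm (by rw [norm_normal]; norm_num), norm_normal]
    simp only [h2, inv_one, one_smul, one_mul]
    rw [← hFs ζ, normal, add_sub_cancel_right]

/-- The point of `C_θ` with a given outer normal. -/
def ofNormal (z : E n) (hz : z ∈ sphericalCap n θ) : cap n θ :=
  ⟨z - Real.cos θ • eLast n, by simpa [cap] using hz⟩

theorem normal_ofNormal (z : E n) (hz : z ∈ sphericalCap n θ) : normal (ofNormal z hz) = z := by
  simp [normal, ofNormal]

theorem normal_mem (ζ : cap n θ) : normal ζ ∈ sphericalCap n θ := ζ.2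

namespace IsHomogeneousExtension

variable {s : cap n θ → ℝ} {H : E n → ℝ} (hH : IsHomogeneousExtension s H)

include hH

theorem hasFDerivAt (z : E n) : HasFDerivAt H (fderiv ℝ H z) z :=
  (hH.contDiff.differentiable (by simp) z).hasFDerivAt

theorem contDiff_fderiv : ContDiff ℝ ∞ (fderiv ℝ H) :=
  hH.contDiff.fderiv_right (m := ∞) (by simp)

theorem hasFDerivAt_fderiv (z : E n) :
    HasFDerivAt (fderiv ℝ H) (fderiv ℝ (fderiv ℝ H) z) z :=
  (hH.contDiff_fderiv.differentiable (by simp) z).hasFDerivAt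

theorem hasFDerivAt_fderiv_fderiv (z : E n) :
    HasFDerivAt (fderiv ℝ (fderiv ℝ H)) (fderiv ℝ (fderiv ℝ (fderiv ℝ H)) z) z :=
  ((hH.contDiff_fderiv.fderiv_right (m := ∞) (by simp)).differentiable (by simp) z).hasFDerivAt

theorem hess_symm (z x y : E n) :
    fderiv ℝ (fderiv ℝ H) z x y = fderiv ℝ (fderiv ℝ H) z y x :=
  (hH.contDiff.contDiffAt.isSymmSndFDerivAt
    (by simpa using (by norm_cast : (2 : WithTop ℕ∞) ≤ ∞))).eq _ _

/-- Euler's identity for a function homogeneous of degree one. -/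
theorem fderiv_self {z : E n} (hz : 1 / 2 < ‖z‖ ^ 2) : fderiv ℝ H z z = H z := by
  have h1 : HasDerivAt (fun t : ℝ => H (t • z)) (fderiv ℝ H z z) 1 := by
    have hl : HasDerivAt (fun t : ℝ => t • z) z 1 := by
      simpa using (hasDerivAt_id (1 : ℝ)).smul_const z
    have := (hH.hasFDerivAt ((1 : ℝ) • z)).comp_hasDerivAt 1 hl
    rwa [one_smul] at this
  have h2 : HasDerivAt (fun t : ℝ => t * H z) (H z) 1 := by
    simpa using (hasDerivAt_id (1 : ℝ)).mul_const (H z)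
  have hev : (fun t : ℝ => H (t • z)) =ᶠ[𝓝 1] fun t => t * H z := by
    have hc : ContinuousAt (fun t : ℝ => ‖t • z‖ ^ 2) 1 := by fun_prop
    filter_upwards [hc.eventually (lt_mem_nhds (a := 1 / 2) (by simpa using hz)),
      lt_mem_nhds (zero_lt_one : (0 : ℝ) < 1)] with t ht htpos
    rw [hH.homogeneous _ ht.le, hH.homogeneous z hz.le, norm_smul, Real.norm_of_nonneg htpos.le,
      mul_inv, smul_smul, mul_right_comm t⁻¹, inv_mul_cancel₀ htpos.ne', one_mul, mul_assoc]
  exact h1.unique (h2.congr_of_eventuallyEq hev)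

theorem hess_self {z : E n} (hz : 1 / 2 < ‖z‖ ^ 2) (v : E n) :
    fderiv ℝ (fderiv ℝ H) z v z = 0 := by
  have h1 : HasFDerivAt (fun y => fderiv ℝ H y y) (fderiv ℝ H z) z := by
    refine (hH.hasFDerivAt z).congr_of_eventuallyEq ?_
    have hc : ContinuousAt (fun y : E n => ‖y‖ ^ 2) z := by fun_prop
    filter_upwards [hc.eventually (lt_mem_nhds hz)] with y hy
    exact hH.fderiv_self hy
  have h2 := (hH.hasFDerivAt_fderiv z).clm_apply (hasFDerivAt_id z)
  have h3 := congrArg (fun A : E n →L[ℝ] ℝ => A v) (h1.unique h2)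
  simpa using h3

theorem hess_self_left {z : E n} (hz : 1 / 2 < ‖z‖ ^ 2) : fderiv ℝ (fderiv ℝ H) z z = 0 := by
  ext v
  rw [hH.hess_symm, hH.hess_self hz]
  rfl

theorem third_self_self {z : E n} (hz : 1 / 2 < ‖z‖ ^ 2) (w : E n) :
    fderiv ℝ (fderiv ℝ (fderiv ℝ H)) z w z z = 0 := by
  have h1 : HasFDerivAt (fun y => fderiv ℝ (fderiv ℝ H) y y y) (0 : E n →L[ℝ] ℝ) z := by
    refine (hasFDerivAt_const (0 : ℝ) z).congr_of_eventuallyEq ?_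
    have hc : ContinuousAt (fun y : E n => ‖y‖ ^ 2) z := by fun_prop
    filter_upwards [hc.eventually (lt_mem_nhds hz)] with y hy
    exact hH.hess_self hy y
  have h2 := ((hH.hasFDerivAt_fderiv_fderiv z).clm_apply (hasFDerivAt_id z)).clm_apply
    (hasFDerivAt_id z)
  have h3 := congrArg (fun A : E n →L[ℝ] ℝ => A w) (h1.unique h2)
  have h4 := hH.hess_self hz w
  have h5 : fderiv ℝ (fderiv ℝ H) z z w = 0 := by rw [hH.hess_self_left hz]; rfl
  simp [h4, h5] at h3
  exact h3.symm

theorem isSmoothExtension_comp_add :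
    IsSmoothExtension s fun x => H (x + Real.cos θ • eLast n) :=
  ⟨hH.contDiff.comp (contDiff_id.add contDiff_const), fun ζ => hH.eq ζ⟩

/-- The Hessian of the homogeneous extension restricts to `τ[s]`. -/
theorem tau_apply (hθ : 0 < Real.sin θ) (ζ : cap n θ) (X Y : tangent ζ) :
    tau s ζ X Y = fderiv ℝ (fderiv ℝ H) (normal ζ) X Y := by
  have h1 : fderiv ℝ (fun x => H (x + Real.cos θ • eLast n)) =
      fun x => fderiv ℝ H (x + Real.cos θ • eLast n) :=
    funext fun x => fderiv_comp_add_right _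
  have h2 : ∀ x, fderiv ℝ (fun x => fderiv ℝ H (x + Real.cos θ • eLast n)) x =
      fderiv ℝ (fderiv ℝ H) (x + Real.cos θ • eLast n) := fun x => fderiv_comp_add_right _
  have h3 : fderiv ℝ H (normal ζ) (normal ζ) = s ζ := by
    rw [hH.fderiv_self (by rw [norm_normal]; norm_num), hH.eq]
  have h4 : tau s ζ X Y = hess s ζ X Y + s ζ * metric ζ X Y := rfl
  rw [h4, hess_eq hθ hH.isSmoothExtension_comp_add, ambientHess_apply, metric_apply, h1, h2]
  change _ - fderiv ℝ H (normal ζ) (normal ζ) * _ + _ = _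
  rw [h3, ← normal]
  ring

theorem inner_tauSharp_eq (hθ : 0 < Real.sin θ) (ζ : cap n θ) (X Y : tangent ζ) :
    ⟪tauSharp s ζ X, Y⟫ = fderiv ℝ (fderiv ℝ H) (normal ζ) X Y := by
  rw [inner_tauSharp, hH.tau_apply hθ]

theorem tauSharp_isSymmetric (hθ : 0 < Real.sin θ) (ζ : cap n θ) :
    (tauSharp s ζ).IsSymmetric := fun X Y => by
  rw [hH.inner_tauSharp_eq hθ, real_inner_comm, hH.inner_tauSharp_eq hθ, hH.hess_symm]

/-- In terms of the homogeneous extension, the Robin condition says that the gradient, which is the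
point of the hypersurface with normal `ν(ζ)`, lies in the hyperplane `{x_{n+1} = 0}`. -/
theorem fderiv_eLast_eq_zero (hθ : 0 < Real.sin θ) {ζ : cap n θ} (hζ : IsBoundary ζ)
    (hb : deriv s ζ (conormal ζ) = Real.cot θ * s ζ) :
    fderiv ℝ H (normal ζ) (eLast n) = 0 := by
  have h1 := deriv_eq hθ hH.isSmoothExtension_comp_add ζ ⟨conormal ζ, conormal_mem_tangent hζ⟩
  rw [hb, fderiv_comp_add_right, ← normal] at h1
  simp only [conormal, map_smul, map_sub, smul_eq_mul,
    hH.fderiv_self (z := normal ζ) (by rw [norm_normal]; norm_num), hH.eq,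
    Real.cot_eq_cos_div_sin] at h1
  field_simp at h1
  linarith

end IsHomogeneousExtension

/-! ### Second-order jets along great circles and the maximum principle -/

theorem sin_pos_of_mem_Ioo {θ : ℝ} (hθ : θ ∈ Set.Ioo 0 (Real.pi / 2)) : 0 < Real.sin θ :=
  Real.sin_pos_of_pos_of_lt_pi hθ.1 (by linarith [hθ.2, Real.pi_pos])

theorem cos_pos_of_mem_Ioo {θ : ℝ} (hθ : θ ∈ Set.Ioo 0 (Real.pi / 2)) : 0 < Real.cos θ :=
  Real.cos_pos_of_mem_Ioo ⟨by linarith [hθ.1, Real.pi_pos], hθ.2⟩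

theorem cos_lt_one_of_mem_Ioo {θ : ℝ} (hθ : θ ∈ Set.Ioo 0 (Real.pi / 2)) : Real.cos θ < 1 := by
  have hsin := sin_pos_of_mem_Ioo hθ
  nlinarith [Real.sin_sq_add_cos_sq θ, pow_pos hsin 2, Real.cos_le_one θ]

/-- The value, the derivative and the second derivative of `g` at `0` are `a`, `b` and `c`. -/
def HasJet (g : ℝ → ℝ) (a b c : ℝ) : Prop :=
  g 0 = a ∧ ∃ g' : ℝ → ℝ, (∀ᶠ t in 𝓝 0, HasDerivAt g (g' t) t) ∧ g' 0 = b ∧ HasDerivAt g' c 0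

namespace HasJet

variable {f g : ℝ → ℝ} {a b c a' b' c' : ℝ}

theorem hasDerivAt (h : HasJet g a b c) : HasDerivAt g b 0 := by
  obtain ⟨-, g', h1, rfl, -⟩ := h
  exact h1.self_of_nhds

theorem const (a : ℝ) : HasJet (fun _ => a) a 0 0 :=
  ⟨rfl, fun _ => 0, .of_forall fun t => hasDerivAt_const t a, rfl, hasDerivAt_const _ _⟩

theorem congr_jet (h : HasJet g a b c) (ha : a = a') (hb : b = b') (hc : c = c') :
    HasJet g a' b' c' := by
  subst ha hb hc
  exact h

theorem sub (hf : HasJet f a b c) (hg : HasJet g a' b' c') :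
    HasJet (fun t => f t - g t) (a - a') (b - b') (c - c') := by
  obtain ⟨rfl, f', h1, rfl, h2⟩ := hf
  obtain ⟨rfl, g', h3, rfl, h4⟩ := hg
  exact ⟨rfl, fun t => f' t - g' t, (h1.and h3).mono fun t h => h.1.sub h.2, rfl, h2.sub h4⟩

theorem mul (hf : HasJet f a b c) (hg : HasJet g a' b' c') :
    HasJet (fun t => f t * g t) (a * a') (b * a' + a * b') (c * a' + 2 * b * b' + a * c') := by
  have hf0 := hf.hasDerivAt
  have hg0 := hg.hasDerivAt
  obtain ⟨rfl, f', h1, rfl, h2⟩ := hf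
  obtain ⟨rfl, g', h3, rfl, h4⟩ := hg
  refine ⟨rfl, fun t => f' t * g t + f t * g' t, (h1.and h3).mono fun t h => h.1.mul h.2, rfl, ?_⟩
  exact ((h2.mul hg0).add (hf0.mul h4)).congr_deriv (by ring)

theorem comp {φ φ' : ℝ → ℝ} {d : ℝ} (hg : HasJet g a b c)
    (hφ : ∀ᶠ x in 𝓝 a, HasDerivAt φ (φ' x) x) (hφ' : HasDerivAt φ' d a) :
    HasJet (fun t => φ (g t)) (φ a) (φ' a * b) (d * b ^ 2 + φ' a * c) := by
  have hg0 := hg.hasDerivAt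
  obtain ⟨rfl, g', h1, rfl, h2⟩ := hg
  refine ⟨rfl, fun t => φ' (g t) * g' t, ?_, rfl, ?_⟩
  · filter_upwards [h1, hg0.continuousAt.eventually hφ] with t ht ht'
    exact ht'.comp t ht
  · exact ((hφ'.comp 0 hg0).mul h2).congr_deriv (by simp only [Function.comp_apply]; ring)

theorem exp (hg : HasJet g a b c) :
    HasJet (fun t => Real.exp (g t)) (Real.exp a) (Real.exp a * b)
      (Real.exp a * b ^ 2 + Real.exp a * c) :=
  hg.comp (.of_forall Real.hasDerivAt_exp) (Real.hasDerivAt_exp a)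

theorem rpow (hg : HasJet g a b c) (ha : 0 < a) (r : ℝ) :
    HasJet (fun t => g t ^ r) (a ^ r) (r * (a ^ r / a) * b)
      (r * (r - 1) * (a ^ r / a ^ 2) * b ^ 2 + r * (a ^ r / a) * c) := by
  have h1 := hg.comp (φ := fun x => x ^ r) (φ' := fun x => r * x ^ (r - 1))
    (d := r * ((r - 1) * a ^ (r - 1 - 1)))
    ((lt_mem_nhds ha).mono fun x hx => Real.hasDerivAt_rpow_const (Or.inl hx.ne'))
    ((Real.hasDerivAt_rpow_const (Or.inl ha.ne')).const_mul r)
  refine h1.congr_jet rfl ?_ ?_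
  · rw [Real.rpow_sub_one ha.ne']
  · rw [Real.rpow_sub_one ha.ne', Real.rpow_sub_one ha.ne', div_div, ← sq]
    ring

/-- The necessary conditions at an interior maximum. -/
theorem of_isLocalMax (h : HasJet g a b c) (hmax : IsLocalMax g 0) : b = 0 ∧ c ≤ 0 := by
  have hb : b = 0 := hmax.hasDerivAt_eq_zero h.hasDerivAt
  refine ⟨hb, ?_⟩
  by_contra! hc
  have hcont := h.hasDerivAt.continuousAt
  have hd := h.hasDerivAt.deriv
  obtain ⟨-, g', h1, -, h2⟩ := h
  have hdd : _root_.deriv g =ᶠ[𝓝 0] g' := h1.mono fun t ht => ht.deriv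
  have hdd0 : _root_.deriv (_root_.deriv g) 0 = c := by rw [hdd.deriv_eq, h2.deriv]
  have hmin := isLocalMin_of_deriv_deriv_pos (hdd0 ▸ hc) (hd.trans hb) hcont
  have hconst : g =ᶠ[𝓝 0] fun _ => g 0 := (hmax.and hmin).mono fun t ht => le_antisymm ht.1 ht.2
  have h0 : _root_.deriv g =ᶠ[𝓝 0] fun _ => 0 :=
    (eventually_eventually_nhds.2 hconst).mono fun t ht => by
      have : g =ᶠ[𝓝 t] fun _ => g 0 := ht
      rw [this.deriv_eq, deriv_const]
  rw [h0.deriv_eq, deriv_const] at hdd0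
  exact hc.ne hdd0

end HasJet

theorem HasDerivAt.nonpos_of_right_max {g : ℝ → ℝ} {b : ℝ} (h : HasDerivAt g b 0)
    (hmax : ∀ᶠ t in 𝓝[>] (0 : ℝ), g t ≤ g 0) : b ≤ 0 := by
  have hs := h.hasDerivWithinAt (s := Set.Ioi 0)
  rw [hasDerivWithinAt_iff_tendsto_slope' (by simp)] at hs
  refine le_of_tendsto hs ?_
  filter_upwards [hmax, self_mem_nhdsWithin] with t ht htpos
  have htpos' : (0 : ℝ) < t := htpos
  rw [slope_def_field]
  exact div_nonpos_of_nonpos_of_nonneg (by linarith) (by linarith)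

/-- The great circle through `z` with velocity `b`. -/
def greatCircle (z b : E n) (t : ℝ) : E n := Real.cos t • z + Real.sin t • b

theorem greatCircle_zero (z b : E n) : greatCircle z b 0 = z := by simp [greatCircle]

theorem hasDerivAt_greatCircle (z b : E n) (t : ℝ) :
    HasDerivAt (greatCircle z b) (-Real.sin t • z + Real.cos t • b) t :=
  ((Real.hasDerivAt_cos t).smul_const z).add ((Real.hasDerivAt_sin t).smul_const b)

theorem norm_greatCircle {z b : E n} (hz : ‖z‖ = 1) (hb : ‖b‖ = 1) (hzb : ⟪z, b⟫ = 0) (t : ℝ) :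
    ‖greatCircle z b t‖ = 1 := by
  have : ‖greatCircle z b t‖ ^ 2 = 1 := by
    rw [greatCircle, norm_add_sq_real, norm_smul, norm_smul, inner_smul_left, inner_smul_right,
      hzb, hz, hb]
    simp
  exact (pow_eq_one_iff_of_nonneg (norm_nonneg _) two_ne_zero).1 this

theorem inner_greatCircle (z b v : E n) (t : ℝ) :
    ⟪greatCircle z b t, v⟫ = Real.cos t * ⟪z, v⟫ + Real.sin t * ⟪b, v⟫ := by
  simp [greatCircle, inner_add_left, inner_smul_left]

theorem hasJet_greatCircle {f : E n → ℝ} {f' : E n → E n →L[ℝ] ℝ} {f'' : E n →L[ℝ] E n →L[ℝ] ℝ}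
    (z b : E n) (hf : ∀ x, HasFDerivAt f (f' x) x) (hf' : HasFDerivAt f' f'' z) :
    HasJet (fun t => f (greatCircle z b t)) (f z) (f' z b) (f'' b b - f' z z) := by
  have hw : HasDerivAt (fun t : ℝ => -Real.sin t • z + Real.cos t • b)
      (-Real.cos 0 • z + -Real.sin 0 • b) 0 :=
    ((Real.hasDerivAt_sin 0).neg.smul_const z).add ((Real.hasDerivAt_cos 0).smul_const b)
  rw [← greatCircle_zero z b] at hf'
  have h1 := (hf'.comp_hasDerivAt 0 (hasDerivAt_greatCircle z b 0)).clm_apply hw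
  refine ⟨congrArg f (greatCircle_zero z b), fun t =>
    f' (greatCircle z b t) (-Real.sin t • z + Real.cos t • b), .of_forall fun t => ?_, ?_, ?_⟩
  · exact (hf _).comp_hasDerivAt t (hasDerivAt_greatCircle z b t)
  · simp [greatCircle_zero]
  · refine h1.congr_deriv ?_
    simp [greatCircle_zero]
    ring

theorem hasJet_inner_greatCircle (z b v : E n) :
    HasJet (fun t => ⟪greatCircle z b t, v⟫) ⟪z, v⟫ ⟪b, v⟫ (-⟪z, v⟫) := by
  have h := hasJet_greatCircle (f := fun x => innerSL ℝ v x) (f' := fun _ => innerSL ℝ v) z b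
    (fun x => (innerSL ℝ v).hasFDerivAt) (hasFDerivAt_const _ _)
  simp only [innerSL_apply_apply] at h
  simp only [real_inner_comm v]
  exact h.congr_jet rfl rfl (by simp)

theorem isBoundary_iff (ζ : cap n θ) : IsBoundary ζ ↔ ⟪normal ζ, eLast n⟫ = Real.cos θ := by
  rw [IsBoundary, normal, inner_add_left, inner_smul_left, real_inner_self_eq_norm_sq, norm_eLast]
  simp

theorem eventually_greatCircle_mem (ζ : cap n θ) {b : E n} (hb : b ∈ tangent ζ) (hb1 : ‖b‖ = 1)
    (hζ : Real.cos θ < ⟪normal ζ, eLast n⟫) :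
    ∀ᶠ t in 𝓝 (0 : ℝ), Real.cos θ < ⟪greatCircle (normal ζ) b t, eLast n⟫ ∧
      greatCircle (normal ζ) b t ∈ sphericalCap n θ := by
  have hc : ContinuousAt (fun t => ⟪greatCircle (normal ζ) b t, eLast n⟫) 0 :=
    (hasJet_inner_greatCircle (normal ζ) b (eLast n)).hasDerivAt.continuousAt
  filter_upwards [hc.eventually (lt_mem_nhds (by simpa [greatCircle_zero] using hζ))] with t ht
  exact ⟨ht, norm_greatCircle (norm_normal ζ) hb1 (mem_tangent.1 hb) t, ht.le⟩

/-- A maximum over the cap of a function that increases inwards at the boundary is attained at an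
interior point, and is a local maximum along every great circle through that point. -/
theorem isLocalMax_of_max (hθ : 0 < Real.sin θ) {Φ : E n → ℝ} {ζ : cap n θ}
    (hmax : ∀ ξ : cap n θ, Φ (normal ξ) ≤ Φ (normal ζ))
    (hbdry : IsBoundary ζ → ∃ r, 0 < r ∧
      HasDerivAt (fun t => Φ (greatCircle (normal ζ) (-conormal ζ) t)) r 0) :
    Real.cos θ < ⟪normal ζ, eLast n⟫ ∧ ∀ b ∈ tangent ζ, ‖b‖ = 1 →
      IsLocalMax (fun t => Φ (greatCircle (normal ζ) b t)) 0 := by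
  have hmax' : ∀ z ∈ sphericalCap n θ, Φ z ≤ Φ (normal ζ) := fun z hz => by
    have := hmax (ofNormal z hz)
    rwa [normal_ofNormal] at this
  have hint : Real.cos θ < ⟪normal ζ, eLast n⟫ := by
    refine lt_of_le_of_ne (normal_mem ζ).2 fun heq => ?_
    have hζ : IsBoundary ζ := (isBoundary_iff ζ).2 heq.symm
    obtain ⟨r, hr, hd⟩ := hbdry hζ
    refine hr.not_ge (HasDerivAt.nonpos_of_right_max hd ?_)
    have hmem := circ_mem ζ (X := -conormal ζ)
      (by rw [inner_neg_right, mem_tangent.1 (conormal_mem_tangent hζ), neg_zero])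
      (by rw [norm_neg, norm_conormal hζ hθ])
      (Or.inr (by rw [inner_neg_left, inner_conormal_eLast hζ hθ]; simpa using hθ))
    filter_upwards [hmem] with t ht
    rw [greatCircle_zero]
    refine hmax' _ ?_
    have : circ ζ (-conormal ζ) t + Real.cos θ • eLast n =
        greatCircle (normal ζ) (-conormal ζ) t := by simp [circ, greatCircle]
    rw [← this]
    exact ht
  refine ⟨hint, fun b hb hb1 => ?_⟩
  filter_upwards [eventually_greatCircle_mem ζ hb hb1 hint] with t ht
  rw [greatCircle_zero]
  exact hmax' _ ht.2

/-! ### Bounds for the extrema -/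

namespace IsHomogeneousExtension

variable {s : cap n θ → ℝ} {H : E n → ℝ} (hH : IsHomogeneousExtension s H)

include hH

theorem fderiv_normal (ζ : cap n θ) : fderiv ℝ H (normal ζ) (normal ζ) = s ζ := by
  rw [hH.fderiv_self (by rw [norm_normal]; norm_num), hH.eq]

theorem hess_normal (ζ : cap n θ) : fderiv ℝ (fderiv ℝ H) (normal ζ) (normal ζ) = 0 :=
  hH.hess_self_left (by rw [norm_normal]; norm_num)

theorem hasJet (ζ : cap n θ) (b : E n) :
    HasJet (fun t => H (greatCircle (normal ζ) b t)) (s ζ) (fderiv ℝ H (normal ζ) b)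
      (fderiv ℝ (fderiv ℝ H) (normal ζ) b b - s ζ) :=
  (hasJet_greatCircle (normal ζ) b hH.hasFDerivAt (hH.hasFDerivAt_fderiv _)).congr_jet
    (hH.eq ζ) rfl (by rw [hH.fderiv_normal])

theorem fderiv_conormal {ζ : cap n θ} (hb : fderiv ℝ H (normal ζ) (eLast n) = 0) :
    fderiv ℝ H (normal ζ) (conormal ζ) = Real.cos θ / Real.sin θ * s ζ := by
  simp only [conormal, map_smul, map_sub, hb, hH.fderiv_normal, smul_eq_mul]
  ring

/-- At a minimum of `s`, the form `τ[s]` is at least `s g`. The Robin condition keeps the minimum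
away from the boundary. -/
theorem le_hess_of_min (hθ : θ ∈ Set.Ioo 0 (Real.pi / 2))
    (hbd : ∀ ζ : cap n θ, IsBoundary ζ → fderiv ℝ H (normal ζ) (eLast n) = 0) {ζ : cap n θ}
    (hpos : 0 < s ζ) (hmin : ∀ ξ : cap n θ, s ζ ≤ s ξ) {b : E n} (hb : b ∈ tangent ζ)
    (hb1 : ‖b‖ = 1) :
    s ζ ≤ fderiv ℝ (fderiv ℝ H) (normal ζ) b b := by
  have hsin := sin_pos_of_mem_Ioo hθ
  have hcos := cos_pos_of_mem_Ioo hθ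
  have hjet := fun v => ((HasJet.const 0).sub (hH.hasJet ζ v))
  obtain ⟨-, hloc⟩ := isLocalMax_of_max hsin (Φ := fun z => 0 - H z) (ζ := ζ)
    (fun ξ => by simpa [hH.eq] using hmin ξ)
    (fun hζ => ⟨_, by
      rw [map_neg, hH.fderiv_conormal (hbd ζ hζ)]
      have : 0 < Real.cos θ / Real.sin θ * s ζ := by positivity
      linarith, (hjet _).hasDerivAt⟩)
  have := ((hjet b).of_isLocalMax (hloc b hb hb1)).2
  linarith

/-- At a maximum of `s exp(λ ⟨ν, e⟩)`, with `λ` large enough for the function to increase inwards at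
the boundary, `τ[s]` is at most a multiple of `s g`. -/
theorem hess_le_of_max (hθ : θ ∈ Set.Ioo 0 (Real.pi / 2))
    (hbd : ∀ ζ : cap n θ, IsBoundary ζ → fderiv ℝ H (normal ζ) (eLast n) = 0) {ζ : cap n θ}
    (hpos : 0 < s ζ)
    (hmax : ∀ ξ : cap n θ, s ξ * Real.exp ((Real.sin θ ^ 2)⁻¹ * ⟪normal ξ, eLast n⟫) ≤
      s ζ * Real.exp ((Real.sin θ ^ 2)⁻¹ * ⟪normal ζ, eLast n⟫))
    {b : E n} (hb : b ∈ tangent ζ) (hb1 : ‖b‖ = 1) :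
    fderiv ℝ (fderiv ℝ H) (normal ζ) b b ≤
      (1 + (Real.sin θ ^ 2)⁻¹ + (Real.sin θ ^ 2)⁻¹ ^ 2) * s ζ := by
  have hsin := sin_pos_of_mem_Ioo hθ
  have hcos := cos_pos_of_mem_Ioo hθ
  set l := (Real.sin θ ^ 2)⁻¹ with hl
  have hlpos : 0 < l := by positivity
  set x := Real.exp (l * ⟪normal ζ, eLast n⟫) with hx
  have hxpos : 0 < x := Real.exp_pos _
  have hjet := fun v => (hH.hasJet ζ v).mul
    ((HasJet.const l).mul (hasJet_inner_greatCircle (normal ζ) v (eLast n))).exp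
  obtain ⟨-, hloc⟩ := isLocalMax_of_max hsin
    (Φ := fun z => H z * Real.exp (l * ⟪z, eLast n⟫)) (ζ := ζ)
    (fun ξ => by simpa [hH.eq] using hmax ξ)
    (fun hζ => ⟨_, by
      rw [map_neg, hH.fderiv_conormal (hbd ζ hζ), inner_neg_left, inner_conormal_eLast hζ hsin,
        ← hx]
      have h1 : l * Real.sin θ = (Real.sin θ)⁻¹ := by rw [hl]; field_simp
      have h2 : Real.cos θ < 1 := by
        nlinarith [Real.sin_sq_add_cos_sq θ, pow_pos hsin 2, Real.cos_le_one θ]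
      have h3 : 0 < (1 - Real.cos θ) * (Real.sin θ)⁻¹ * s ζ * x := by
        have : 0 < 1 - Real.cos θ := by linarith
        positivity
      calc (0 : ℝ) < (1 - Real.cos θ) * (Real.sin θ)⁻¹ * s ζ * x := h3
        _ = _ := by rw [div_eq_mul_inv]; linear_combination (-s ζ * x) * h1, (hjet _).hasDerivAt⟩)
  obtain ⟨h1, h2⟩ := (hjet b).of_isLocalMax (hloc b hb hb1)
  have hy1 : ⟪normal ζ, eLast n⟫ ≤ 1 := by
    simpa [norm_normal, norm_eLast] using real_inner_le_norm (normal ζ) (eLast n)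
  have he1 : ⟪b, eLast n⟫ ^ 2 ≤ 1 := by
    have := abs_real_inner_le_norm b (eLast n)
    rw [hb1, norm_eLast, mul_one] at this
    rw [sq_le_one_iff_abs_le_one]
    exact this
  rw [← hx] at h1 h2
  set D := fderiv ℝ H (normal ζ) b
  set D2 := fderiv ℝ (fderiv ℝ H) (normal ζ) b b
  set y := ⟪normal ζ, eLast n⟫
  set ε := ⟪b, eLast n⟫
  have h1' : D = -(s ζ * l * ε) := by
    have : x * (D + s ζ * l * ε) = 0 := by linear_combination h1
    rcases mul_eq_zero.1 this with h | h
    · exact absurd h hxpos.ne'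
    · linarith
  have h2' : x * (D2 - s ζ - s ζ * (l * ε) ^ 2 - s ζ * l * y) ≤ 0 := by
    rw [h1'] at h2
    linarith
  have h3 : D2 - s ζ - s ζ * (l * ε) ^ 2 - s ζ * l * y ≤ 0 := by
    by_contra! hcon
    exact (mul_pos hxpos hcon).not_ge h2'
  have h4 : s ζ * l * y ≤ s ζ * l := mul_le_of_le_one_right (by positivity) hy1
  have h5 : s ζ * (l * ε) ^ 2 ≤ s ζ * l ^ 2 := by
    rw [mul_pow, ← mul_assoc]
    exact mul_le_of_le_one_right (by positivity) he1
  linarith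

end IsHomogeneousExtension

/-! ### The gradient estimate -/

/-- The support function `ℓ = ⟨ζ, ν⟩ = 1 - cos θ ⟨ν, e⟩` of the cap itself. -/
def capSupport (ζ : cap n θ) : ℝ := 1 - Real.cos θ * ⟪normal ζ, eLast n⟫

theorem inner_coe_normal (ζ : cap n θ) : ⟪(ζ : E n), normal ζ⟫ = capSupport ζ := by
  have h : (ζ : E n) = normal ζ - Real.cos θ • eLast n := by simp [normal]
  rw [h, inner_sub_left, inner_smul_left, real_inner_self_eq_norm_sq, norm_normal, capSupport,
    real_inner_comm]
  simp

theorem inner_normal_eLast_le (ζ : cap n θ) : ⟪normal ζ, eLast n⟫ ≤ 1 := by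
  simpa [norm_normal, norm_eLast] using real_inner_le_norm (normal ζ) (eLast n)

theorem le_capSupport (hc : 0 < Real.cos θ) (ζ : cap n θ) :
    1 - Real.cos θ ≤ capSupport ζ := by
  have := mul_le_of_le_one_right hc.le (inner_normal_eLast_le ζ)
  rw [capSupport]
  linarith

theorem capSupport_le_one (hc : 0 < Real.cos θ) (ζ : cap n θ) : capSupport ζ ≤ 1 := by
  have := mul_pos hc (hc.trans_le (normal_mem ζ).2)
  rw [capSupport]
  linarith

/-- For a homogeneous extension `H` of `s`, this is `ℓ ∇(s / ℓ)`, written as the difference of the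
point `∇H` of the hypersurface with normal `ν(ζ)` and of the point `ζ` scaled by `s / ℓ`. -/
def quotientGradient (s : cap n θ → ℝ) (H : E n → ℝ) (ζ : cap n θ) : E n :=
  (InnerProductSpace.toDual ℝ (E n)).symm (fderiv ℝ H (normal ζ)) -
    (s ζ / capSupport ζ) • (ζ : E n)

theorem inner_quotientGradient (s : cap n θ → ℝ) (H : E n → ℝ) (ζ : cap n θ) (v : E n) :
    ⟪quotientGradient s H ζ, v⟫ =
      fderiv ℝ H (normal ζ) v - s ζ / capSupport ζ * ⟪(ζ : E n), v⟫ := by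
  rw [quotientGradient, inner_sub_left, InnerProductSpace.toDual_symm_apply, inner_smul_left]
  simp

theorem inner_coe (ζ : cap n θ) (v : E n) :
    ⟪(ζ : E n), v⟫ = ⟪normal ζ, v⟫ - Real.cos θ * ⟪eLast n, v⟫ := by
  rw [normal, inner_add_left, inner_smul_left]
  simp

/-- The terms of indefinite sign in the second-order condition are absorbed by the good ones when
the ratio `r` is small. -/
theorem absorbed_terms_nonneg {r l z₁ z₂ y σ h δ : ℝ} (hδ : 0 < δ) (hδl : δ ≤ l) (hl1 : l ≤ 1)
    (hz₁ : |z₁| ≤ 1) (hz₂ : |z₂| ≤ 1) (h0 : 0 < h) (h1 : h < 1) (hr : 0 < r)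
    (hr' : 8 * r ≤ δ ^ 2 * (h * (1 - h))) (hy : y = r * (l * σ - z₂)) :
    0 ≤ l * h + r * z₁ + 2 * z₁ * z₂ * y / l - 2 * y ^ 2 + l * h * (1 - h) * σ ^ 2 := by
  have hl : 0 < l := hδ.trans_le hδl
  have hδ1 : δ ≤ 1 := hδl.trans hl1
  have hhh : h * (1 - h) ≤ 1 := by nlinarith [sq_nonneg (h - 1 / 2)]
  have hhpos : 0 < h * (1 - h) := mul_pos h0 (by linarith)
  have hσ2 : 2 * |σ| ≤ σ ^ 2 + 1 := by nlinarith [sq_nonneg (|σ| - 1), sq_abs σ]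
  have hσl : |l * σ - z₂| ≤ |σ| + 1 := by
    have e1 : l * |σ| ≤ |σ| := mul_le_of_le_one_left (abs_nonneg σ) hl1
    have e2 : |l * σ - z₂| ≤ |l * σ| + |z₂| := abs_sub _ _
    rw [abs_mul, abs_of_pos hl] at e2
    linarith
  have hyabs : |y| ≤ r * (|σ| + 1) := by
    rw [hy, abs_mul, abs_of_pos hr]
    exact mul_le_mul_of_nonneg_left hσl hr.le
  have hr1 : r ≤ 1 := by
    have : δ ^ 2 * (h * (1 - h)) ≤ 1 :=
      mul_le_one₀ (pow_le_one₀ hδ.le hδ1) hhpos.le hhh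
    linarith
  have hsq : y ^ 2 ≤ r * (2 * (σ ^ 2 + 1)) := by
    have e1 : y ^ 2 ≤ (r * (|σ| + 1)) ^ 2 := by
      rw [← sq_abs y]
      exact pow_le_pow_left₀ (abs_nonneg _) hyabs 2
    have e2 : (|σ| + 1) ^ 2 ≤ 2 * (σ ^ 2 + 1) := by
      have := sq_abs σ
      linarith [add_sq |σ| 1]
    have e3 : r ^ 2 ≤ r := by
      rw [sq]
      exact mul_le_of_le_one_left hr.le hr1
    rw [mul_pow] at e1
    exact e1.trans (mul_le_mul e3 e2 (sq_nonneg _) hr.le)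
  set t := r / δ with ht
  have htpos : 0 < t := div_pos hr hδ
  have hrt : r ≤ t := by
    rw [ht, le_div_iff₀ hδ]
    exact mul_le_of_le_one_right hr.le hδ1
  have hcross : -(t * (σ ^ 2 + 3)) ≤ 2 * z₁ * z₂ * y / l := by
    have e1 : |2 * z₁ * z₂ * y / l| ≤ 2 * |y| / δ := by
      rw [abs_div, abs_mul, abs_mul, abs_mul, abs_two, abs_of_pos hl]
      have e2 : 2 * |z₁| * |z₂| * |y| ≤ 2 * |y| := by
        rw [mul_assoc 2]
        have : |z₁| * |z₂| ≤ 1 := mul_le_one₀ hz₁ (abs_nonneg _) hz₂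
        exact mul_le_mul_of_nonneg_right (by linarith) (abs_nonneg y)
      exact div_le_div₀ (by positivity) e2 hδ hδl
    have e2 : 2 * |y| / δ ≤ t * (σ ^ 2 + 3) := by
      rw [ht, div_mul_eq_mul_div]
      refine div_le_div_of_nonneg_right ?_ hδ.le
      have : r * (2 * |σ| + 2) ≤ r * (σ ^ 2 + 3) :=
        mul_le_mul_of_nonneg_left (by linarith) hr.le
      linarith
    linarith [neg_abs_le (2 * z₁ * z₂ * y / l)]
  have e2 : t * 8 ≤ δ * (h * (1 - h)) := by
    rw [ht, div_mul_eq_mul_div, div_le_iff₀ hδ]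
    linarith
  have e3 : -t ≤ r * z₁ := by
    have e4 : r * -1 ≤ r * z₁ := mul_le_mul_of_nonneg_left (abs_le.1 hz₁).1 hr.le
    linarith
  have e4 : δ * (h * (1 - h)) ≤ l * h :=
    mul_le_mul hδl (mul_le_of_le_one_right h0.le (by linarith)) hhpos.le hl.le
  have e5 : δ * (h * (1 - h)) * σ ^ 2 ≤ l * h * (1 - h) * σ ^ 2 := by
    rw [mul_assoc l h]
    gcongr
  have e6 : r * (4 * (σ ^ 2 + 1)) ≤ t * (4 * (σ ^ 2 + 1)) :=
    mul_le_mul_of_nonneg_right hrt (by positivity)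
  have e7 : t * 8 * σ ^ 2 ≤ δ * (h * (1 - h)) * σ ^ 2 :=
    mul_le_mul_of_nonneg_right e2 (sq_nonneg σ)
  have e8 : 0 ≤ t * σ ^ 2 := mul_nonneg htpos.le (sq_nonneg σ)
  linarith

/-- The algebra behind the gradient estimate: from the first- and second-order conditions at a
maximum, in the direction of an eigenvector of `τ[s]` with eigenvalue `d`, a bound for the third
derivative `t`. -/
theorem third_le_of_conditions {s q l z₁ z₂ y a d t h δ : ℝ} (hs : 0 < s) (hq : 0 < q)
    (hδ : 0 < δ) (hδl : δ ≤ l) (hl1 : l ≤ 1) (hz₁ : |z₁| ≤ 1) (hz₂ : |z₂| ≤ 1)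
    (h0 : 0 < h) (h1 : h < 1) (hr : 8 * (s / l) ≤ δ ^ 2 * (h * (1 - h)) * q)
    (ha : a = q * y + s / l * z₂)
    (hfirst : l * (d * y) = q * z₁ * y + s * y + q * l * h * (a / s))
    (hsecond : s / l * z₁ + 2 * z₂ * (d * y) - 2 * (s / l) * z₂ * y + l * t - d * z₁ -
        2 * q * y ^ 2 ≤
      q * (2 * z₂ * h * (a / s) + l * (h * ((d - s) / s) - h * (1 - h) * (a / s) ^ 2))) :
    l * t ≤ d * (z₁ + q * l * h / s) := by
  have hl : 0 < l := hδ.trans_le hδl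
  set σ := a / s with hσ
  obtain ⟨r, hrdef⟩ : ∃ r, s / l = r * q := ⟨s / l / q, by field_simp⟩
  have hs' : s = r * q * l := by rw [← hrdef]; field_simp
  have hrpos : 0 < r := by
    have : 0 < r * q := hrdef ▸ div_pos hs hl
    exact pos_of_mul_pos_left this hq.le
  have hr' : 8 * r ≤ δ ^ 2 * (h * (1 - h)) := by
    rw [hrdef] at hr
    exact le_of_mul_le_mul_right (by linarith) hq
  have hy : y = r * (l * σ - z₂) := by
    have e1 : a = σ * s := by rw [hσ]; field_simp
    rw [e1, hrdef, hs'] at ha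
    refine mul_left_cancel₀ hq.ne' ?_
    linear_combination -ha
  have hdy : d * y = q * z₁ * y / l + r * q * y + q * h * σ := by
    refine mul_left_cancel₀ hl.ne' ?_
    rw [hfirst, hs']
    field_simp
  have hX := mul_nonneg hq.le (absorbed_terms_nonneg hδ hδl hl1 hz₁ hz₂ h0 h1 hrpos hr' hy)
  have hds : d * (z₁ + q * l * h / s) = d * z₁ + q * (l * (h * ((d - s) / s))) + q * l * h := by
    field_simp
    ring
  rw [hds]
  rw [hdy, hrdef] at hsecond
  have e1 : q * z₁ * y / l = q * (z₁ * y / l) := by ring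
  have e2 : 2 * z₁ * z₂ * y / l = 2 * z₂ * (z₁ * y / l) := by ring
  rw [e1] at hsecond
  rw [e2] at hX
  linarith

namespace IsHomogeneousExtension

variable {s : cap n θ → ℝ} {H : E n → ℝ} (hH : IsHomogeneousExtension s H)

include hH

theorem quotientGradient_mem_tangent (hc : 0 < Real.cos θ) (hc1 : Real.cos θ < 1) (ζ : cap n θ) :
    quotientGradient s H ζ ∈ tangent ζ := by
  have h : capSupport ζ ≠ 0 := by
    have := le_capSupport hc ζ
    intro h0
    rw [h0] at this
    linarith
  rw [mem_tangent, real_inner_comm, inner_quotientGradient, hH.fderiv_normal, inner_coe_normal]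
  field_simp
  ring

theorem third_symm (z x y v : E n) :
    fderiv ℝ (fderiv ℝ (fderiv ℝ H)) z x y v = fderiv ℝ (fderiv ℝ (fderiv ℝ H)) z y x v := by
  have := (hH.contDiff_fderiv.contDiffAt (x := z)).isSymmSndFDerivAt
    (by simpa using (by norm_cast : (2 : WithTop ℕ∞) ≤ ∞))
  rw [this.eq x y]

/-- Tangential differentiation of the Robin condition along the boundary: `τ[s]` does not mix the
conormal with the directions tangent to the boundary. -/
theorem hess_eLast_eq_zero (hbd : ∀ ζ : cap n θ, IsBoundary ζ → fderiv ℝ H (normal ζ) (eLast n) = 0)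
    (hsin : 0 < Real.sin θ) {ζ : cap n θ} (hζ : IsBoundary ζ) {w : E n} (hw : w ∈ tangent ζ)
    (hw1 : ‖w‖ = 1) (hwe : ⟪w, eLast n⟫ = 0) :
    fderiv ℝ (fderiv ℝ H) (normal ζ) w (eLast n) = 0 := by
  have hζe : ⟪(ζ : E n), eLast n⟫ = 0 := hζ
  have hee : ⟪eLast n, eLast n⟫ = (1 : ℝ) := by
    rw [real_inner_self_eq_norm_sq, norm_eLast, one_pow]
  have hζw : ⟪(ζ : E n), w⟫ = 0 := by
    rw [inner_coe, mem_tangent.1 hw, real_inner_comm, hwe]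
    simp
  have hζζ : ‖(ζ : E n)‖ ^ 2 = Real.sin θ ^ 2 := by
    have h1 := norm_normal ζ
    have h2 : ‖normal ζ‖ ^ 2 = ‖(ζ : E n)‖ ^ 2 + Real.cos θ ^ 2 := by
      rw [normal, norm_add_sq_real, inner_smul_right, hζe, norm_smul, norm_eLast]
      simp
    rw [h1] at h2
    nlinarith [Real.sin_sq_add_cos_sq θ]
  set c : ℝ → E n := fun t => greatCircle (ζ : E n) (Real.sin θ • w) t + Real.cos θ • eLast n
    with hc
  have hce : ∀ t, ⟪c t, eLast n⟫ = Real.cos θ := fun t => by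
    simp only [hc]
    rw [inner_add_left, inner_greatCircle, hζe, inner_smul_left, hwe, inner_smul_left, hee]
    simp
  have hgc : ∀ t, ⟪greatCircle (ζ : E n) (Real.sin θ • w) t, eLast n⟫ = 0 := fun t => by
    rw [inner_greatCircle, hζe, inner_smul_left, hwe]
    simp
  have hnorm : ∀ t, ‖c t‖ = 1 := fun t => by
    have h1 : ‖c t‖ ^ 2 = 1 := by
      simp only [hc]
      rw [norm_add_sq_real, inner_smul_right, hgc, greatCircle, norm_add_sq_real, norm_smul,
        norm_smul, norm_smul, norm_smul, inner_smul_left, inner_smul_right, inner_smul_right, hζw,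
        mul_pow, hζζ, hw1, norm_eLast]
      simp only [Real.norm_eq_abs, mul_pow, sq_abs]
      simp only [mul_one, mul_zero, add_zero, one_pow]
      linear_combination Real.sin θ ^ 2 * Real.sin_sq_add_cos_sq t + Real.sin_sq_add_cos_sq θ
    exact (pow_eq_one_iff_of_nonneg (norm_nonneg _) two_ne_zero).1 h1
  have hzero : ∀ t, fderiv ℝ H (c t) (eLast n) = 0 := fun t => by
    have hmem : c t ∈ sphericalCap n θ := ⟨hnorm t, (hce t).ge⟩
    have := hbd (ofNormal (c t) hmem)
      ((isBoundary_iff _).2 (by rw [normal_ofNormal, hce]))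
    rwa [normal_ofNormal] at this
  have hc0 : c 0 = normal ζ := by simp [hc, greatCircle_zero, normal]
  have hcd : HasDerivAt c (Real.sin θ • w) 0 := by
    exact ((hasDerivAt_greatCircle (ζ : E n) (Real.sin θ • w) 0).add_const
      (Real.cos θ • eLast n)).congr_deriv (by simp)
  have h1 := ((hH.hasFDerivAt_fderiv (c 0)).comp_hasDerivAt 0 hcd).clm_apply
    (hasDerivAt_const (0 : ℝ) (eLast n))
  have h2 : HasDerivAt (fun t => fderiv ℝ H (c t) (eLast n)) 0 0 := by
    simp only [hzero]
    exact hasDerivAt_const _ _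
  have h3 := h1.unique h2
  rw [hc0] at h3
  simp only [map_smul, map_zero, add_zero, _root_.smul_apply, smul_eq_mul] at h3
  exact (mul_eq_zero.1 h3).resolve_left hsin.ne'

/-- The differentiated equation, in an orthonormal frame diagonalising `τ[s]`. -/
theorem exists_frame_sum_third {k : ℕ} (hk : 1 ≤ k) (hkn : k ≤ n) {p : ℝ}
    (hsin : 0 < Real.sin θ) {φ : cap n θ → ℝ} {Φ : E n → ℝ} (hΦ : IsSmoothExtension φ Φ)
    (hconv : IsStrictlyConvex s) (hsol : IsSolution k p φ s) {ζ : cap n θ} (hφ : 0 < φ ζ)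
    (hpos : 0 < s ζ) (hζ : Real.cos θ < ⟪normal ζ, eLast n⟫) {w : E n} (hw : w ∈ tangent ζ)
    (hw1 : ‖w‖ = 1) :
    ∃ (b : Fin n → E n) (d S : Fin n → ℝ), (∀ i, b i ∈ tangent ζ) ∧ (∀ i, ‖b i‖ = 1) ∧
      (∀ i, 0 ≤ S i) ∧
      (∀ i, fderiv ℝ (fderiv ℝ H) (normal ζ) (b i) (b i) = d i) ∧
      (∀ i, fderiv ℝ (fderiv ℝ H) (normal ζ) w (b i) = d i * ⟪w, b i⟫) ∧
      ∑ i, S i * d i = k * (s ζ ^ (p - 1) * φ ζ) ∧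
      ∑ i, S i * fderiv ℝ (fderiv ℝ (fderiv ℝ H)) (normal ζ) w (b i) (b i) =
        s ζ ^ (p - 1) * φ ζ *
          ((p - 1) * (fderiv ℝ H (normal ζ) w / s ζ) + fderiv ℝ Φ (ζ : E n) w / φ ζ) := by
  obtain ⟨B, d, hB0, hBt, hd, hchar⟩ := exists_frame ζ (hH.hess_symm (normal ζ))
    (hH.hess_normal ζ) (hH.inner_tauSharp_eq hsin ζ)
  have hdpos : ∀ i, 0 < d i := fun i => by
    have h1 := hconv ζ ⟨B (some i), hBt i⟩ (by
      intro h0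
      have : B (some i) = 0 := congrArg Subtype.val h0
      have h2 := B.orthonormal.1 (some i)
      rw [this, norm_zero] at h2
      exact zero_ne_one h2)
    rw [hH.tau_apply hsin] at h1
    simpa [hd] using h1
  have hkn' : k ≤ Fintype.card (Fin n) := by simpa using hkn
  refine ⟨fun i => B (some i), d, sigmaPartial k d, hBt, fun i => B.orthonormal.1 _,
    sigmaPartial_nonneg hk hkn' fun i => (hdpos i).le, fun i => by simp [hd], fun i => ?_, ?_, ?_⟩
  · -- Expand `w` in the frame.
    conv_lhs => rw [← B.sum_repr w]
    rw [map_sum, sum_apply, Finset.sum_eq_single (some i)]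
    · rw [map_smul, _root_.smul_apply, hd, B.repr_apply_apply, real_inner_comm]
      simp [mul_comm]
    · intro o _ ho
      rw [map_smul, _root_.smul_apply, hd, if_neg ho, smul_zero]
    · simp
  · rw [sum_sigmaPartial_mul hk hkn', ← hchar, Fintype.card_fin,
      ← sigma_eq_coeff (hH.tauSharp_isSymmetric hsin ζ) (finrank_tangent ζ) hkn, hsol.equation]
  · have hA : ∀ x y, HasDerivAt
        (fun t => fderiv ℝ (fderiv ℝ H) (greatCircle (normal ζ) w t) x y)
        (fderiv ℝ (fderiv ℝ (fderiv ℝ H)) (normal ζ) w x y) 0 := fun x y => by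
      have h1 : HasFDerivAt (fun z => fderiv ℝ (fderiv ℝ H) z x y)
          (((fderiv ℝ (fderiv ℝ (fderiv ℝ H)) (normal ζ)).flip x).flip y)
          (greatCircle (normal ζ) w 0) := by
        rw [greatCircle_zero]
        refine (((hH.hasFDerivAt_fderiv_fderiv (normal ζ)).clm_apply
          (hasFDerivAt_const x (normal ζ))).clm_apply
          (hasFDerivAt_const y (normal ζ))).congr_fderiv ?_
        ext v
        simp
      exact (h1.comp_hasDerivAt 0 (hasDerivAt_greatCircle (normal ζ) w 0)).congr_deriv (by simp)
    have h1 := hasDerivAt_sigma hA (B := B) (d := d)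
      (by simpa only [greatCircle_zero] using hd)
      (by rw [hB0, hH.third_self_self (by rw [norm_normal]; norm_num)]) hk hkn
    have h2 : (fun t => (-1 : ℝ) ^ k * (toOperator (fderiv ℝ (fderiv ℝ H)
        (greatCircle (normal ζ) w t))).charpoly.coeff (n + 1 - k)) =ᶠ[𝓝 0]
        fun t => H (greatCircle (normal ζ) w t) ^ (p - 1) *
          Φ (greatCircle (normal ζ) w t - Real.cos θ • eLast n) := by
      filter_upwards [eventually_greatCircle_mem ζ hw hw1 hζ] with t ht
      set ξ := ofNormal _ ht.2 with hξ
      have hξn : normal ξ = greatCircle (normal ζ) w t := normal_ofNormal _ _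
      have e1 : (ξ : E n) = greatCircle (normal ζ) w t - Real.cos θ • eLast n := rfl
      rw [← e1, ← hξn, hH.eq, hΦ.2, ← hsol.equation]
      exact (sigma_eq_coeff_toOperator ξ (hH.hess_symm (normal ξ)) (hH.hess_normal ξ)
        (hH.inner_tauSharp_eq hsin ξ) hkn).symm
    have h3 : HasDerivAt (fun t => H (greatCircle (normal ζ) w t) ^ (p - 1))
        ((p - 1) * (s ζ ^ (p - 1) / s ζ) * fderiv ℝ H (normal ζ) w) 0 :=
      ((hH.hasJet ζ w).rpow hpos (p - 1)).hasDerivAt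
    have h4 : HasDerivAt (fun t => Φ (greatCircle (normal ζ) w t - Real.cos θ • eLast n))
        (fderiv ℝ Φ (ζ : E n) w) 0 := by
      have e1 : greatCircle (normal ζ) w 0 - Real.cos θ • eLast n = (ζ : E n) := by
        simp [greatCircle_zero, normal]
      have e2 := (hΦ.1.differentiable (by simp)
        (greatCircle (normal ζ) w 0 - Real.cos θ • eLast n)).hasFDerivAt.comp_hasDerivAt 0
        ((hasDerivAt_greatCircle (normal ζ) w 0).sub_const (Real.cos θ • eLast n))
      rw [e1] at e2
      exact e2.congr_deriv (by simp)
    have h5 := (h1.congr_of_eventuallyEq h2.symm).unique (h3.mul h4)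
    rw [h5]
    simp only [greatCircle_zero, hH.eq]
    have e1 : normal ζ - Real.cos θ • eLast n = (ζ : E n) := by simp [normal]
    rw [e1, hΦ.2]
    field_simp

end IsHomogeneousExtension

/-- A function on the ambient space that touches `|W| - κ s ^ h` from below, up to the factor `ℓ`,
where `W` is the quotient gradient; `w` is the direction of `W` at the point of contact. -/
def touching (θ : ℝ) (H : E n → ℝ) (w : E n) (κ h : ℝ) (z : E n) : ℝ :=
  (1 - Real.cos θ * ⟪z, eLast n⟫) * fderiv ℝ H z w -
    H z * (⟪z, w⟫ - Real.cos θ * ⟪eLast n, w⟫) -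
    κ * ((1 - Real.cos θ * ⟪z, eLast n⟫) * H z ^ h)

theorem touching_normal {s : cap n θ → ℝ} {H : E n → ℝ} (hH : IsHomogeneousExtension s H)
    {ξ : cap n θ} (hξ : 0 < capSupport ξ) (w : E n) (κ h : ℝ) :
    touching θ H w κ h (normal ξ) =
      capSupport ξ * (⟪quotientGradient s H ξ, w⟫ - κ * s ξ ^ h) := by
  rw [touching, inner_quotientGradient, inner_coe, hH.eq, ← capSupport]
  field_simp

namespace IsHomogeneousExtension

variable {s : cap n θ → ℝ} {H : E n → ℝ} (hH : IsHomogeneousExtension s H)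

include hH

theorem hasJet_fderiv (ζ : cap n θ) (w b : E n) :
    HasJet (fun t => fderiv ℝ H (greatCircle (normal ζ) b t) w) (fderiv ℝ H (normal ζ) w)
      (fderiv ℝ (fderiv ℝ H) (normal ζ) w b)
      (fderiv ℝ (fderiv ℝ (fderiv ℝ H)) (normal ζ) w b b) := by
  have hsymm : ∀ z, (fderiv ℝ (fderiv ℝ H) z).flip w = fderiv ℝ (fderiv ℝ H) z w := fun z => by
    ext v
    exact hH.hess_symm z v w
  have h1 : ∀ x, HasFDerivAt (fun x => fderiv ℝ H x w) (fderiv ℝ (fderiv ℝ H) x w) x := fun x => by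
    refine ((hH.hasFDerivAt_fderiv x).clm_apply (hasFDerivAt_const w x)).congr_fderiv ?_
    rw [← hsymm]
    simp
  have h2 : HasFDerivAt (fun x => fderiv ℝ (fderiv ℝ H) x w)
      ((fderiv ℝ (fderiv ℝ (fderiv ℝ H)) (normal ζ)).flip w) (normal ζ) := by
    refine ((hH.hasFDerivAt_fderiv_fderiv (normal ζ)).clm_apply
      (hasFDerivAt_const w (normal ζ))).congr_fderiv ?_
    simp
  refine (hasJet_greatCircle (normal ζ) b h1 h2).congr_jet rfl rfl ?_
  rw [hH.hess_self (by rw [norm_normal]; norm_num), ContinuousLinearMap.flip_apply, hH.third_symm,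
    sub_zero]

theorem hasJet_touching (ζ : cap n θ) (hpos : 0 < s ζ) {w : E n} (hw : w ∈ tangent ζ) (b : E n)
    {q h κ : ℝ} (hκ : κ * s ζ ^ h = q) :
    HasJet (fun t => touching θ H w κ h (greatCircle (normal ζ) b t))
      (touching θ H w κ h (normal ζ))
      (-(Real.cos θ * ⟪b, eLast n⟫) * fderiv ℝ H (normal ζ) w +
        capSupport ζ * fderiv ℝ (fderiv ℝ H) (normal ζ) w b -
        (fderiv ℝ H (normal ζ) b * ⟪(ζ : E n), w⟫ + s ζ * ⟪b, w⟫) -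
        q * (-(Real.cos θ * ⟪b, eLast n⟫) + capSupport ζ * (h * (fderiv ℝ H (normal ζ) b / s ζ))))
      ((1 - capSupport ζ) * fderiv ℝ H (normal ζ) w +
        2 * -(Real.cos θ * ⟪b, eLast n⟫) * fderiv ℝ (fderiv ℝ H) (normal ζ) w b +
        capSupport ζ * fderiv ℝ (fderiv ℝ (fderiv ℝ H)) (normal ζ) w b b -
        ((fderiv ℝ (fderiv ℝ H) (normal ζ) b b - s ζ) * ⟪(ζ : E n), w⟫ +
          2 * fderiv ℝ H (normal ζ) b * ⟪b, w⟫) -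
        q * ((1 - capSupport ζ) +
          2 * -(Real.cos θ * ⟪b, eLast n⟫) * (h * (fderiv ℝ H (normal ζ) b / s ζ)) +
          capSupport ζ * (h * ((fderiv ℝ (fderiv ℝ H) (normal ζ) b b - s ζ) / s ζ) -
            h * (1 - h) * (fderiv ℝ H (normal ζ) b / s ζ) ^ 2))) := by
  have hl := (HasJet.const 1).sub
    ((HasJet.const (Real.cos θ)).mul (hasJet_inner_greatCircle (normal ζ) b (eLast n)))
  have hm := (hasJet_inner_greatCircle (normal ζ) b w).sub
    (HasJet.const (Real.cos θ * ⟪eLast n, w⟫))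
  have hjet := ((hl.mul (hH.hasJet_fderiv ζ w b)).sub ((hH.hasJet ζ b).mul hm)).sub
    ((HasJet.const κ).mul (hl.mul ((hH.hasJet ζ b).rpow hpos h)))
  refine hjet.congr_jet ?_ ?_ ?_
  · rw [touching, hH.eq]
  · rw [inner_coe, mem_tangent.1 hw, ← hκ, capSupport]
    ring
  · rw [inner_coe, mem_tangent.1 hw, ← hκ, capSupport]
    field_simp
    ring

/-- At a maximum of `|W| / s ^ h`, with `W` the quotient gradient, `|W|` is bounded by a multiple of
`s / ℓ`. -/
theorem norm_quotientGradient_le_of_max {k : ℕ} (hk : 1 ≤ k) (hkn : k ≤ n) {p : ℝ} (hp : 1 < p)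
    (hθ : θ ∈ Set.Ioo 0 (Real.pi / 2)) {φ : cap n θ → ℝ} {Φ : E n → ℝ}
    (hΦ : IsSmoothExtension φ Φ) (hφ : ∀ ζ, 0 < φ ζ) {C : ℝ}
    (hC : ∀ (ζ : cap n θ) (w : E n), ‖w‖ = 1 → |fderiv ℝ Φ (ζ : E n) w| ≤ C * φ ζ)
    (hconv : IsStrictlyConvex s) (hsol : IsSolution k p φ s) (hpos : ∀ ζ, 0 < s ζ)
    (hbd : ∀ ζ : cap n θ, IsBoundary ζ → fderiv ℝ H (normal ζ) (eLast n) = 0)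
    {h r : ℝ} (h0 : 0 < h) (h1 : h < 1) (hr : 0 < r)
    (hr1 : 8 * r ≤ (1 - Real.cos θ) ^ 2 * (h * (1 - h)))
    (hr2 : r * (p - 1 + C + k) ≤ p - 1 - h * k) {ζ : cap n θ}
    (hmax : ∀ ξ : cap n θ, ‖quotientGradient s H ξ‖ * s ζ ^ h ≤
      ‖quotientGradient s H ζ‖ * s ξ ^ h) :
    r * ‖quotientGradient s H ζ‖ ≤ s ζ / capSupport ζ := by
  have hsin := sin_pos_of_mem_Ioo hθ
  have hcos := cos_pos_of_mem_Ioo hθ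
  have hcos1 := cos_lt_one_of_mem_Ioo hθ
  have hl0 : ∀ ξ : cap n θ, 0 < capSupport ξ := fun ξ =>
    lt_of_lt_of_le (by linarith) (le_capSupport hcos ξ)
  by_contra! hcon
  set q := ‖quotientGradient s H ζ‖ with hq
  set l := capSupport ζ with hl
  have hu : 0 < s ζ / l := div_pos (hpos ζ) (hl0 ζ)
  have hqpos : 0 < q := pos_of_mul_pos_right (hu.trans hcon) hr.le
  set w := q⁻¹ • quotientGradient s H ζ with hwdef
  have hw1 : ‖w‖ = 1 := by
    rw [hwdef, norm_smul, norm_inv, ← hq, Real.norm_of_nonneg hqpos.le, inv_mul_cancel₀ hqpos.ne']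
  have hW : quotientGradient s H ζ = q • w := by
    rw [hwdef, smul_smul, mul_inv_cancel₀ hqpos.ne', one_smul]
  have hw : w ∈ tangent ζ :=
    Submodule.smul_mem _ _ (hH.quotientGradient_mem_tangent hcos hcos1 ζ)
  have hsh : 0 < s ζ ^ h := Real.rpow_pos_of_pos (hpos ζ) h
  set κ := q / s ζ ^ h with hκdef
  have hκ : κ * s ζ ^ h = q := by rw [hκdef, div_mul_cancel₀ _ hsh.ne']
  -- The gradient of the homogeneous extension in terms of the quotient gradient.
  have hDH : ∀ v, fderiv ℝ H (normal ζ) v = q * ⟪w, v⟫ + s ζ / l * ⟪(ζ : E n), v⟫ := fun v => by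
    have := inner_quotientGradient s H ζ v
    rw [hW, inner_smul_left] at this
    simp only [conj_trivial] at this
    linarith
  have hDHw : fderiv ℝ H (normal ζ) w = q + s ζ / l * ⟪(ζ : E n), w⟫ := by
    rw [hDH, real_inner_self_eq_norm_sq, hw1]
    ring
  have hζt : ∀ v ∈ tangent ζ, ⟪(ζ : E n), v⟫ = -(Real.cos θ * ⟪v, eLast n⟫) := fun v hv => by
    rw [inner_coe, mem_tangent.1 hv, real_inner_comm]
    ring
  have hζ1 : ∀ v ∈ tangent ζ, ‖v‖ = 1 → |⟪(ζ : E n), v⟫| ≤ 1 := fun v hv hv1 => by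
    rw [hζt v hv, abs_neg, abs_mul, abs_of_pos hcos]
    have := abs_real_inner_le_norm v (eLast n)
    rw [hv1, norm_eLast, mul_one] at this
    exact mul_le_one₀ hcos1.le (abs_nonneg _) this
  have hjet := fun v => hH.hasJet_touching ζ (hpos ζ) hw v hκ
  have htouch0 : touching θ H w κ h (normal ζ) = 0 := by
    rw [touching_normal hH (hl0 ζ), hκ, hW, inner_smul_left, real_inner_self_eq_norm_sq, hw1]
    simp
  have htouch : ∀ ξ : cap n θ, touching θ H w κ h (normal ξ) ≤ touching θ H w κ h (normal ζ) :=
    fun ξ => by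
      rw [htouch0, touching_normal hH (hl0 ξ)]
      refine mul_nonpos_of_nonneg_of_nonpos (hl0 ξ).le ?_
      have e1 : ⟪quotientGradient s H ξ, w⟫ ≤ ‖quotientGradient s H ξ‖ := by
        simpa [hw1] using real_inner_le_norm (quotientGradient s H ξ) w
      have e2 : ‖quotientGradient s H ξ‖ ≤ κ * s ξ ^ h := by
        rw [hκdef, div_mul_eq_mul_div, le_div_iff₀ hsh]
        exact hmax ξ
      linarith
  obtain ⟨hint, hloc⟩ := isLocalMax_of_max hsin (Φ := touching θ H w κ h) htouch
    (fun hζ => ⟨_, by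
      have hζe : ⟪(ζ : E n), eLast n⟫ = 0 := hζ
      have hwe : ⟪w, eLast n⟫ = 0 := by
        have := hDH (eLast n)
        rw [hbd ζ hζ, hζe, mul_zero, add_zero] at this
        exact (mul_eq_zero.1 this.symm).resolve_left hqpos.ne'
      have hζw : ⟪(ζ : E n), w⟫ = 0 := by rw [hζt w hw, hwe]; simp
      have hcw : ⟪conormal ζ, w⟫ = 0 := by
        rw [real_inner_comm]
        exact inner_conormal ζ hw hwe
      have hhess : fderiv ℝ (fderiv ℝ H) (normal ζ) w (conormal ζ) = 0 := by
        rw [conormal, map_smul, map_sub, map_smul, hH.hess_eLast_eq_zero hbd hsin hζ hw hw1 hwe,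
          hH.hess_self (by rw [norm_normal]; norm_num)]
        simp
      rw [hDHw, hζw, map_neg, map_neg, hhess, hH.fderiv_conormal (hbd ζ hζ), inner_neg_left,
        inner_neg_left, hcw, inner_conormal_eLast hζ hsin]
      have e1 : 0 < q * (l * (h * (Real.cos θ / Real.sin θ))) := by
        have := hl0 ζ
        positivity
      have e2 : Real.cos θ / Real.sin θ * s ζ / s ζ = Real.cos θ / Real.sin θ :=
        mul_div_cancel_right₀ _ (hpos ζ).ne'
      rw [neg_div, e2]
      linarith, (hjet _).hasDerivAt⟩)
  obtain ⟨b, d, S, hb, hb1, hS, hd, hwb, hsum, hsum3⟩ :=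
    hH.exists_frame_sum_third hk hkn hsin hΦ hconv hsol (hφ ζ) (hpos ζ) hint hw hw1
  set F := s ζ ^ (p - 1) * φ ζ with hF
  have hFpos : 0 < F := mul_pos (Real.rpow_pos_of_pos (hpos ζ) _) (hφ ζ)
  set z₁ := ⟪(ζ : E n), w⟫ with hz₁
  have hz₁1 : |z₁| ≤ 1 := hζ1 w hw hw1
  have hdir : ∀ i, l * fderiv ℝ (fderiv ℝ (fderiv ℝ H)) (normal ζ) w (b i) (b i) ≤
      d i * (z₁ + q * l * h / s ζ) := fun i => by
    obtain ⟨e1, e2⟩ := (hjet (b i)).of_isLocalMax (hloc (b i) (hb i) (hb1 i))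
    have e3 := hDH (b i)
    have hsl : s ζ / l * l = s ζ := div_mul_cancel₀ _ (hl0 ζ).ne'
    rw [← hζt (b i) (hb i), hDHw, real_inner_comm w (b i), hwb, ← hl] at e1 e2
    rw [hd] at e2
    refine third_le_of_conditions (hpos ζ) hqpos (by linarith : 0 < 1 - Real.cos θ)
      (le_capSupport hcos ζ) (capSupport_le_one hcos ζ) hz₁1 (hζ1 (b i) (hb i) (hb1 i)) h0 h1
      (y := ⟪w, b i⟫) ?_ e3 ?_ ?_
    · have := mul_le_mul_of_nonneg_right hr1 hqpos.le
      linarith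
    · linear_combination e1 + z₁ * e3
    · have e4 : fderiv ℝ H (normal ζ) (b i) * ⟪w, b i⟫ =
          q * ⟪w, b i⟫ ^ 2 + s ζ / l * ⟪(ζ : E n), b i⟫ * ⟪w, b i⟫ := by
        rw [e3]
        ring
      have e5 : l * (s ζ / l * z₁) = s ζ * z₁ := by linear_combination z₁ * hsl
      linarith
  have hsumle : l * (F * ((p - 1) * (fderiv ℝ H (normal ζ) w / s ζ) +
      fderiv ℝ Φ (ζ : E n) w / φ ζ)) ≤ (k * F) * (z₁ + q * l * h / s ζ) := by
    rw [← hsum3, ← hsum, Finset.mul_sum, Finset.sum_mul]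
    refine Finset.sum_le_sum fun i _ => ?_
    have := mul_le_mul_of_nonneg_left (hdir i) (hS i)
    linarith
  have hΦw : -C ≤ fderiv ℝ Φ (ζ : E n) w / φ ζ := by
    rw [le_div_iff₀ (hφ ζ)]
    have := (abs_le.1 (hC ζ w hw1)).1
    linarith
  have hC0 : 0 ≤ C := by
    have e1 := (abs_nonneg _).trans (hC ζ w hw1)
    exact nonneg_of_mul_nonneg_left e1 (hφ ζ)
  set x := fderiv ℝ Φ (ζ : E n) w / φ ζ with hx
  have hle : l * ((p - 1) * (fderiv ℝ H (normal ζ) w / s ζ) + x) ≤ k * (z₁ + q * l * h / s ζ) := by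
    refine le_of_mul_le_mul_left (?_ : F * _ ≤ F * _) hFpos
    linarith
  rw [hDHw] at hle
  -- Multiply by `u = s / ℓ`.
  set u := s ζ / l with hudef
  have hle2 : (p - 1) * (q + u * z₁) + u * (l * x) ≤ k * (u * z₁ + q * h) := by
    have e1 := mul_le_mul_of_nonneg_left hle hu.le
    have hs0 := (hpos ζ).ne'
    have hl0' := (hl0 ζ).ne'
    have e2 : u * (l * ((p - 1) * ((q + u * z₁) / s ζ) + x)) =
        (p - 1) * (q + u * z₁) + u * (l * x) := by
      have : u * l = s ζ := div_mul_cancel₀ _ hl0'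
      field_simp
      linear_combination ((p - 1) * (q + u * z₁)) * this
    have e3 : u * (k * (z₁ + q * l * h / s ζ)) = k * (u * z₁ + q * h) := by
      have : u * l = s ζ := div_mul_cancel₀ _ hl0'
      field_simp
      linear_combination (q * h) * this
    rwa [e2, e3] at e1
  have hlx : -C ≤ l * x := by
    have e1 : l * -C ≤ l * x := mul_le_mul_of_nonneg_left hΦw (hl0 ζ).le
    have e2 : l * C ≤ C := mul_le_of_le_one_left hC0 (capSupport_le_one hcos ζ)
    linarith
  have hz := abs_le.1 hz₁1
  have hkR : (0 : ℝ) < k := by exact_mod_cast hk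
  have hsumpos : 0 < p - 1 + C + k := by linarith
  have e1 : u * -C ≤ u * (l * x) := mul_le_mul_of_nonneg_left hlx hu.le
  have e2 : (p - 1) * (u * -1) ≤ (p - 1) * (u * z₁) :=
    mul_le_mul_of_nonneg_left (mul_le_mul_of_nonneg_left hz.1 hu.le) (by linarith)
  have e3 : k * (u * z₁) ≤ k * (u * 1) :=
    mul_le_mul_of_nonneg_left (mul_le_mul_of_nonneg_left hz.2 hu.le) hkR.le
  have e4 : (p - 1 - h * k) * q ≤ u * (p - 1 + C + k) := by linarith
  have e5 : u * (p - 1 + C + k) < r * q * (p - 1 + C + k) := mul_lt_mul_of_pos_right hcon hsumpos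
  have e6 := mul_le_mul_of_nonneg_right hr2 hqpos.le
  linarith

end IsHomogeneousExtension

/-! ### Meridians of the cap -/

/-- Sturm comparison for `g'' + g > 0` on `[0, θ]` with `g'(0) = 0` and `g'(θ) = cot θ g(θ)`: the
quotient `g / cos` increases and the quotient `g / sin` decreases. -/
theorem sturm_comparison (hθ : θ ∈ Set.Ioo 0 (Real.pi / 2)) {g g' K : ℝ → ℝ}
    (hg : ∀ t, HasDerivAt g (g' t) t) (hg' : ∀ t, HasDerivAt g' (K t - g t) t)
    (hK : ∀ t ∈ Set.Icc 0 θ, 0 < K t) (h0 : g' 0 = 0)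
    (hb : g' θ * Real.sin θ = Real.cos θ * g θ) :
    0 < g 0 ∧ ∀ t ∈ Set.Icc 0 θ, Real.cos t * g 0 ≤ g t ∧
      Real.cos θ * g t ≤ Real.cos t * g θ ∧ Real.sin t * g θ ≤ Real.sin θ * g t := by
  have hsin : ∀ t ∈ Set.Ioc 0 θ, 0 < Real.sin t := fun t ht =>
    Real.sin_pos_of_pos_of_lt_pi ht.1 (by linarith [ht.2, hθ.2, Real.pi_pos])
  have hcos : ∀ t ∈ Set.Icc 0 θ, 0 < Real.cos t := fun t ht =>
    Real.cos_pos_of_mem_Ioo ⟨by linarith [ht.1, Real.pi_pos], by linarith [ht.2, hθ.2]⟩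
  have hq : ∀ t, HasDerivAt (fun t => g' t * Real.sin t - g t * Real.cos t)
      (K t * Real.sin t) t := fun t =>
    (((hg' t).mul (Real.hasDerivAt_sin t)).sub ((hg t).mul (Real.hasDerivAt_cos t))).congr_deriv
      (by ring)
  have hr : ∀ t, HasDerivAt (fun t => g' t * Real.cos t + g t * Real.sin t)
      (K t * Real.cos t) t := fun t =>
    (((hg' t).mul (Real.hasDerivAt_cos t)).add ((hg t).mul (Real.hasDerivAt_sin t))).congr_deriv
      (by ring)
  have hqmono : StrictMonoOn (fun t => g' t * Real.sin t - g t * Real.cos t) (Set.Icc 0 θ) := by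
    refine strictMonoOn_of_deriv_pos (convex_Icc 0 θ)
      (fun t _ => (hq t).continuousAt.continuousWithinAt) fun t ht => ?_
    rw [interior_Icc] at ht
    rw [(hq t).deriv]
    exact mul_pos (hK t ⟨ht.1.le, ht.2.le⟩) (hsin t ⟨ht.1, ht.2.le⟩)
  have hrmono : MonotoneOn (fun t => g' t * Real.cos t + g t * Real.sin t) (Set.Icc 0 θ) := by
    refine monotoneOn_of_deriv_nonneg (convex_Icc 0 θ)
      (fun t _ => (hr t).continuousAt.continuousWithinAt)
      (fun t _ => (hr t).differentiableAt.differentiableWithinAt) fun t ht => ?_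
    rw [interior_Icc] at ht
    rw [(hr t).deriv]
    exact (mul_pos (hK t ⟨ht.1.le, ht.2.le⟩) (hcos t ⟨ht.1.le, ht.2.le⟩)).le
  have hmem0 : (0 : ℝ) ∈ Set.Icc 0 θ := ⟨le_rfl, hθ.1.le⟩
  have hmemθ : θ ∈ Set.Icc 0 θ := ⟨hθ.1.le, le_rfl⟩
  have hqnonpos : ∀ t ∈ Set.Icc 0 θ, g' t * Real.sin t - g t * Real.cos t ≤ 0 := fun t ht => by
    have := hqmono.monotoneOn ht hmemθ ht.2
    linarith
  have hrnonneg : ∀ t ∈ Set.Icc 0 θ, 0 ≤ g' t * Real.cos t + g t * Real.sin t := fun t ht => by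
    have := hrmono hmem0 ht ht.1
    simpa [h0] using this
  have hg0 : 0 < g 0 := by
    have := hqmono hmem0 hmemθ hθ.1
    simp only [Real.sin_zero, Real.cos_zero, mul_zero, mul_one, zero_sub] at this
    linarith
  have hdc : ∀ t ∈ Set.Icc 0 θ, HasDerivAt (fun t => g t / Real.cos t)
      ((g' t * Real.cos t + g t * Real.sin t) / Real.cos t ^ 2) t := fun t ht =>
    ((hg t).div (Real.hasDerivAt_cos t) (hcos t ht).ne').congr_deriv (by ring)
  have hds : ∀ t ∈ Set.Ioc 0 θ, HasDerivAt (fun t => g t / Real.sin t)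
      ((g' t * Real.sin t - g t * Real.cos t) / Real.sin t ^ 2) t := fun t ht =>
    (hg t).div (Real.hasDerivAt_sin t) (hsin t ht).ne'
  have hmono : MonotoneOn (fun t => g t / Real.cos t) (Set.Icc 0 θ) := by
    refine monotoneOn_of_deriv_nonneg (convex_Icc 0 θ)
      (fun t ht => (hdc t ht).continuousAt.continuousWithinAt)
      (fun t ht => (hdc t (interior_subset ht)).differentiableAt.differentiableWithinAt)
      fun t ht => ?_
    rw [(hdc t (interior_subset ht)).deriv]
    exact div_nonneg (hrnonneg t (interior_subset ht)) (sq_nonneg _)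
  have hanti : AntitoneOn (fun t => g t / Real.sin t) (Set.Ioc 0 θ) := by
    refine antitoneOn_of_deriv_nonpos (convex_Ioc 0 θ)
      (fun t ht => (hds t ht).continuousAt.continuousWithinAt)
      (fun t ht => (hds t (interior_subset ht)).differentiableAt.differentiableWithinAt)
      fun t ht => ?_
    have ht' := interior_subset ht
    rw [(hds t ht').deriv]
    exact div_nonpos_of_nonpos_of_nonneg (hqnonpos t ⟨ht'.1.le, ht'.2⟩) (sq_nonneg _)
  refine ⟨hg0, fun t ht => ⟨?_, ?_, ?_⟩⟩
  · have := hmono hmem0 ht ht.1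
    simp only [Real.cos_zero, div_one] at this
    rw [le_div_iff₀ (hcos t ht)] at this
    linarith
  · have := hmono ht hmemθ ht.2
    simp only at this
    rw [div_le_div_iff₀ (hcos t ht) (hcos θ hmemθ)] at this
    linarith
  · rcases ht.1.eq_or_lt with rfl | htpos
    · simpa using (mul_pos (hsin θ ⟨hθ.1, le_rfl⟩) hg0).le
    · have := hanti ⟨htpos, ht.2⟩ ⟨hθ.1, le_rfl⟩ ht.2
      simp only at this
      rw [div_le_div_iff₀ (hsin θ ⟨hθ.1, le_rfl⟩) (hsin t ⟨htpos, ht.2⟩)] at this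
      linarith

theorem rpow_growth {u u' : ℝ → ℝ} {A h T : ℝ} (hA : 0 ≤ A) (h0 : 0 < h) (h1 : h < 1)
    (hu : ∀ t ∈ Set.Icc 0 T, HasDerivAt u (u' t) t) (hpos : ∀ t ∈ Set.Icc 0 T, 0 < u t)
    (hle : ∀ t ∈ Set.Icc 0 T, u' t ≤ A * u t ^ h) {t : ℝ} (ht : t ∈ Set.Icc 0 T) :
    u t ^ (1 - h) ≤ u 0 ^ (1 - h) + A * t := by
  have hd : ∀ x ∈ Set.Icc 0 T, HasDerivAt (fun t => u t ^ (1 - h))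
      (u' x * (1 - h) * u x ^ (1 - h - 1)) x := fun x hx =>
    (hu x hx).rpow_const (Or.inl (hpos x hx).ne')
  have hmem0 : (0 : ℝ) ∈ Set.Icc 0 T := ⟨le_rfl, ht.1.trans ht.2⟩
  have := (convex_Icc 0 T).image_sub_le_mul_sub_of_deriv_le (f := fun t => u t ^ (1 - h)) (C := A)
    (fun x hx => (hd x hx).continuousAt.continuousWithinAt)
    (fun x hx => (hd x (interior_subset hx)).differentiableAt.differentiableWithinAt)
    (fun x hx => by
      have hx' := interior_subset hx
      have hux := Real.rpow_pos_of_pos (hpos x hx') (1 - h - 1)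
      rw [(hd x hx').deriv]
      have e1 : u x ^ h * u x ^ (1 - h - 1) = 1 := by
        rw [← Real.rpow_add (hpos x hx')]
        simp
      calc u' x * (1 - h) * u x ^ (1 - h - 1) = (1 - h) * (u' x * u x ^ (1 - h - 1)) := by ring
        _ ≤ (1 - h) * (A * u x ^ h * u x ^ (1 - h - 1)) :=
          mul_le_mul_of_nonneg_left (mul_le_mul_of_nonneg_right (hle x hx') hux.le) (by linarith)
        _ = (1 - h) * A := by rw [mul_assoc A, e1, mul_one]
        _ ≤ A := mul_le_of_le_one_left hA (by linarith))
    0 hmem0 t ht ht.1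
  simp only [sub_zero] at this
  linarith

/-- Near `t = 0` the sublinear bound `(c sin t) ^ (1 - h)` beats the linear term `A t`. -/
theorem exists_lower_bound (hθ : θ ∈ Set.Ioo 0 (Real.pi / 2)) {A h c : ℝ} (h0 : 0 < h) (h1 : h < 1)
    (hc : 0 < c) :
    ∃ t ∈ Set.Icc 0 θ, ∃ ε, 0 < ε ∧ ∀ x, 0 ≤ x →
      (c * Real.sin t) ^ (1 - h) ≤ x ^ (1 - h) + A * t → ε ≤ x := by
  have hpi := Real.pi_pos
  set a := c * (2 / Real.pi) with ha
  have hapos : 0 < a := by positivity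
  have hcont : ContinuousAt (fun t : ℝ => A * t ^ h) 0 :=
    continuousAt_const.mul (Real.continuousAt_rpow_const 0 h (Or.inr h0.le))
  have hev1 : ∀ᶠ t in 𝓝[>] (0 : ℝ), A * t ^ h < a ^ (1 - h) :=
    nhdsWithin_le_nhds (hcont.eventually (gt_mem_nhds
      (by simpa [Real.zero_rpow h0.ne'] using Real.rpow_pos_of_pos hapos (1 - h))))
  obtain ⟨t, ht1, ht2, ht3⟩ :=
    (hev1.and ((eventually_mem_nhdsWithin).and (nhdsWithin_le_nhds (gt_mem_nhds hθ.1)))).exists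
  have htpos : 0 < t := ht2
  have hlt : A * t < (c * Real.sin t) ^ (1 - h) := by
    have e1 : a * t ≤ c * Real.sin t := by
      have := mul_le_mul_of_nonneg_left (Real.mul_le_sin htpos.le (by linarith [hθ.2])) hc.le
      rw [ha]
      linarith
    have e2 : (a * t) ^ (1 - h) ≤ (c * Real.sin t) ^ (1 - h) :=
      Real.rpow_le_rpow (by positivity) e1 (by linarith)
    have e3 : t ^ h * t ^ (1 - h) = t := by
      rw [← Real.rpow_add htpos]
      simp
    rw [Real.mul_rpow hapos.le htpos.le] at e2
    have e4 := mul_lt_mul_of_pos_right ht1 (Real.rpow_pos_of_pos htpos (1 - h))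
    rw [mul_assoc, e3] at e4
    linarith
  refine ⟨t, ⟨htpos.le, ht3.le⟩, ((c * Real.sin t) ^ (1 - h) - A * t) ^ (1 - h)⁻¹,
    Real.rpow_pos_of_pos (by linarith) _, fun x hx hle => ?_⟩
  have e1 : (c * Real.sin t) ^ (1 - h) - A * t ≤ x ^ (1 - h) := by linarith
  calc ((c * Real.sin t) ^ (1 - h) - A * t) ^ (1 - h)⁻¹ ≤ (x ^ (1 - h)) ^ (1 - h)⁻¹ :=
        Real.rpow_le_rpow (by linarith) e1 (inv_nonneg.2 (by linarith))
    _ = x := Real.rpow_rpow_inv hx (by linarith)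

theorem inner_eLast_self : ⟪eLast n, eLast n⟫ = (1 : ℝ) := by
  rw [real_inner_self_eq_norm_sq, norm_eLast, one_pow]

theorem inner_meridian {v : E n} (hv : ⟪eLast n, v⟫ = 0) (t : ℝ) :
    ⟪greatCircle (eLast n) v t, eLast n⟫ = Real.cos t := by
  rw [inner_greatCircle, inner_eLast_self, real_inner_comm, hv]
  ring

theorem meridian_mem (hθ : θ ∈ Set.Ioo 0 (Real.pi / 2)) {v : E n} (hv : ⟪eLast n, v⟫ = 0)
    (hv1 : ‖v‖ = 1) {t : ℝ} (ht : |t| ≤ θ) : greatCircle (eLast n) v t ∈ sphericalCap n θ := by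
  refine ⟨norm_greatCircle norm_eLast hv1 hv t, ?_⟩
  rw [inner_meridian hv, ← Real.cos_abs t]
  exact Real.cos_le_cos_of_nonneg_of_le_pi (abs_nonneg t) (by linarith [hθ.2, Real.pi_pos]) ht

/-- Every point of the spherical cap lies on a meridian. -/
theorem exists_meridian (hn : 1 ≤ n) (hθ : θ ∈ Set.Ioo 0 (Real.pi / 2)) {z : E n}
    (hz : z ∈ sphericalCap n θ) :
    ∃ v : E n, ‖v‖ = 1 ∧ ⟪eLast n, v⟫ = 0 ∧ ∃ t ∈ Set.Icc 0 θ, z = greatCircle (eLast n) v t := by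
  have hy1 : ⟪z, eLast n⟫ ≤ 1 := by
    simpa [hz.1, norm_eLast] using real_inner_le_norm z (eLast n)
  set y := ⟪z, eLast n⟫ with hy
  have hcos := cos_pos_of_mem_Ioo hθ
  have hyθ : Real.cos θ ≤ y := hz.2
  have hct : Real.cos (Real.arccos y) = y := Real.cos_arccos (by linarith) hy1
  have hpyth : ‖z - y • eLast n‖ ^ 2 = Real.sin (Real.arccos y) ^ 2 := by
    have := Real.sin_sq_add_cos_sq (Real.arccos y)
    rw [hct] at this
    rw [norm_sub_sq_real, inner_smul_right, ← hy, hz.1, norm_smul, norm_eLast, mul_one,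
      Real.norm_eq_abs, sq_abs]
    linarith
  have hst : 0 ≤ Real.sin (Real.arccos y) := Real.sin_arccos y ▸ Real.sqrt_nonneg _
  have hnorm : ‖z - y • eLast n‖ = Real.sin (Real.arccos y) := by
    rwa [sq_eq_sq₀ (norm_nonneg _) hst] at hpyth
  have hmem : Real.arccos y ∈ Set.Icc 0 θ := by
    refine ⟨Real.arccos_nonneg y, ?_⟩
    have := Real.arccos_le_arccos hyθ
    rwa [Real.arccos_cos hθ.1.le (by linarith [hθ.2, Real.pi_pos])] at this
  rcases hst.eq_or_lt with h0 | hpos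
  · -- At the pole the meridian is not unique.
    have hze : z = y • eLast n := by
      rw [← sub_eq_zero, ← norm_eq_zero, hnorm, ← h0]
    refine ⟨EuclideanSpace.single ⟨0, by omega⟩ 1, by simp, ?_, Real.arccos y, hmem, ?_⟩
    · rw [real_inner_comm, inner_eLast]
      simp
      omega
    · rw [greatCircle, hct, ← h0, zero_smul, add_zero]
      exact hze
  · refine ⟨(Real.sin (Real.arccos y))⁻¹ • (z - y • eLast n), ?_, ?_, Real.arccos y, hmem, ?_⟩
    · rw [norm_smul, hnorm, norm_inv, Real.norm_of_nonneg hst, inv_mul_cancel₀ hpos.ne']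
    · rw [inner_smul_right, inner_sub_right, inner_smul_right, inner_eLast_self, real_inner_comm,
        ← hy]
      simp
    · rw [greatCircle, hct, smul_smul, mul_inv_cancel₀ hpos.ne', one_smul]
      abel

theorem reflect_greatCircle {v : E n} (hv : ⟪eLast n, v⟫ = 0) (t : ℝ) :
    reflect (greatCircle (eLast n) v t - Real.cos θ • eLast n) =
      greatCircle (eLast n) v (-t) - Real.cos θ • eLast n := by
  rw [real_inner_comm, inner_eLast] at hv
  ext i
  by_cases hi : i = Fin.last n
  · subst hi
    simp [reflect, greatCircle, hv]
  · simp [reflect, greatCircle, hi, eLast]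

namespace IsHomogeneousExtension

variable {s : cap n θ → ℝ} {H : E n → ℝ} (hH : IsHomogeneousExtension s H)

include hH

/-- Bounds along a meridian, from strict convexity, evenness and the Robin condition. -/
theorem meridian_bounds (hθ : θ ∈ Set.Ioo 0 (Real.pi / 2)) (hconv : IsStrictlyConvex s)
    (heven : IsEven s)
    (hbd : ∀ ζ : cap n θ, IsBoundary ζ → fderiv ℝ H (normal ζ) (eLast n) = 0)
    {v : E n} (hv : ⟪eLast n, v⟫ = 0) (hv1 : ‖v‖ = 1) :
    0 < H (eLast n) ∧ ∀ t ∈ Set.Icc 0 θ,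
      Real.cos t * H (eLast n) ≤ H (greatCircle (eLast n) v t) ∧
      Real.cos θ * H (greatCircle (eLast n) v t) ≤
        Real.cos t * H (greatCircle (eLast n) v θ) ∧
      Real.sin t * H (greatCircle (eLast n) v θ) ≤
        Real.sin θ * H (greatCircle (eLast n) v t) := by
  have hsin := sin_pos_of_mem_Ioo hθ
  set c : ℝ → E n := greatCircle (eLast n) v with hc
  set c' : ℝ → E n := fun t => -Real.sin t • eLast n + Real.cos t • v with hc'
  have hcc' : ∀ t, HasDerivAt c (c' t) t := hasDerivAt_greatCircle _ _
  have hcn : ∀ t, ‖c t‖ = 1 := norm_greatCircle norm_eLast hv1 hv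
  have hc'' : ∀ t, HasDerivAt c' (-c t) t := fun t => by
    have := ((Real.hasDerivAt_sin t).neg.smul_const (eLast n)).add
      ((Real.hasDerivAt_cos t).smul_const v)
    refine this.congr_deriv ?_
    simp only [hc, greatCircle, neg_smul, neg_add]
  have hc0 : c 0 = eLast n := greatCircle_zero _ _
  have hg : ∀ t, HasDerivAt (fun t => H (c t)) (fderiv ℝ H (c t) (c' t)) t := fun t =>
    (hH.hasFDerivAt (c t)).comp_hasDerivAt t (hcc' t)
  have hg' : ∀ t, HasDerivAt (fun t => fderiv ℝ H (c t) (c' t))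
      (fderiv ℝ (fderiv ℝ H) (c t) (c' t) (c' t) - H (c t)) t := fun t => by
    have h1 := ((hH.hasFDerivAt_fderiv (c t)).comp_hasDerivAt t (hcc' t)).clm_apply (hc'' t)
    refine h1.congr_deriv ?_
    rw [← hH.fderiv_self (z := c t) (by rw [hcn]; norm_num)]
    simp [sub_eq_add_neg]
  have hK : ∀ t ∈ Set.Icc 0 θ, 0 < fderiv ℝ (fderiv ℝ H) (c t) (c' t) (c' t) := fun t ht => by
    have hmem : c t ∈ sphericalCap n θ :=
      meridian_mem hθ hv hv1 (by rw [abs_of_nonneg ht.1]; exact ht.2)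
    have htan : c' t ∈ tangent (ofNormal (c t) hmem) := by
      rw [mem_tangent, normal_ofNormal]
      simp only [hc, hc', inner_greatCircle, inner_add_right, inner_smul_right, hv, norm_eLast,
        real_inner_self_eq_norm_sq, hv1, real_inner_comm (eLast n) v]
      ring
    have hne : c' t ≠ 0 := fun h0 => by
      have e1 : ‖c' t‖ ^ 2 = 1 := by
        simp only [hc']
        rw [norm_add_sq_real, norm_smul, norm_smul, inner_smul_left, inner_smul_right, hv,
          norm_eLast, hv1]
        simp
      rw [h0, norm_zero] at e1
      norm_num at e1
    have := hconv (ofNormal (c t) hmem) ⟨c' t, htan⟩ fun h0 => hne (congrArg Subtype.val h0)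
    rwa [hH.tau_apply hsin, normal_ofNormal] at this
  have hzero : fderiv ℝ H (c 0) (c' 0) = 0 := by
    have h1 : HasDerivAt (fun t => H (c (-t))) (-(fderiv ℝ H (c 0) (c' 0))) 0 := by
      have := HasDerivAt.comp (0 : ℝ) (h₂ := fun t => H (c t)) (h := fun t => -t)
        (by rw [neg_zero]; exact hg 0) (hasDerivAt_neg (0 : ℝ))
      exact this.congr_deriv (by simp)
    have h2 : (fun t => H (c (-t))) =ᶠ[𝓝 0] fun t => H (c t) := by
      have hev : ∀ᶠ t in 𝓝 (0 : ℝ), |t| < θ :=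
        continuous_abs.continuousAt.eventually (gt_mem_nhds (by simpa using hθ.1))
      filter_upwards [hev] with t ht
      have hm1 : c t ∈ sphericalCap n θ := meridian_mem hθ hv hv1 ht.le
      have hm2 : c (-t) ∈ sphericalCap n θ := meridian_mem hθ hv hv1 (by rw [abs_neg]; exact ht.le)
      have := heven (ofNormal _ hm1) (ofNormal _ hm2) (reflect_greatCircle hv t).symm
      rwa [← hH.eq, ← hH.eq, normal_ofNormal, normal_ofNormal] at this
    have h3 := (h1.congr_of_eventuallyEq h2.symm).unique (hg 0)
    linarith
  have hθb : fderiv ℝ H (c θ) (c' θ) * Real.sin θ = Real.cos θ * H (c θ) := by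
    have hmem : c θ ∈ sphericalCap n θ := meridian_mem hθ hv hv1 (abs_of_pos hθ.1).le
    have h1 := hbd (ofNormal _ hmem)
      ((isBoundary_iff _).2 (by rw [normal_ofNormal, hc, inner_meridian hv]))
    rw [normal_ofNormal] at h1
    have h2 := hH.fderiv_self (z := c θ) (by rw [hcn]; norm_num)
    have e1 : fderiv ℝ H (c θ) (c' θ) = Real.cos θ * fderiv ℝ H (c θ) v := by
      simp only [hc', map_add, map_smul, h1, smul_eq_mul]
      ring
    have e2 : H (c θ) = Real.sin θ * fderiv ℝ H (c θ) v := by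
      have : fderiv ℝ H (c θ) (Real.cos θ • eLast n + Real.sin θ • v) = H (c θ) := h2
      rw [← this, map_add, map_smul, map_smul, h1]
      simp
    rw [e1, e2]
    ring
  have := sturm_comparison hθ hg hg' hK hzero hθb
  rwa [hc0] at this

theorem eq_meridian (hn : 1 ≤ n) (hθ : θ ∈ Set.Ioo 0 (Real.pi / 2)) (ζ : cap n θ) :
    ∃ v : E n, ‖v‖ = 1 ∧ ⟪eLast n, v⟫ = 0 ∧ ∃ t ∈ Set.Icc 0 θ,
      s ζ = H (greatCircle (eLast n) v t) := by
  obtain ⟨v, hv1, hv, t, ht, hz⟩ := exists_meridian hn hθ (normal_mem ζ)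
  exact ⟨v, hv1, hv, t, ht, by rw [← hz, hH.eq]⟩

/-- The value at the pole is comparable to the minimum. -/
theorem cos_mul_pole_le (hn : 1 ≤ n) (hθ : θ ∈ Set.Ioo 0 (Real.pi / 2)) (hconv : IsStrictlyConvex s)
    (heven : IsEven s)
    (hbd : ∀ ζ : cap n θ, IsBoundary ζ → fderiv ℝ H (normal ζ) (eLast n) = 0) (ζ : cap n θ) :
    0 < H (eLast n) ∧ Real.cos θ * H (eLast n) ≤ s ζ := by
  obtain ⟨v, hv1, hv, t, ht, hs⟩ := hH.eq_meridian hn hθ ζ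
  obtain ⟨h0, h1⟩ := hH.meridian_bounds hθ hconv heven hbd hv hv1
  refine ⟨h0, ?_⟩
  rw [hs]
  refine le_trans (mul_le_mul_of_nonneg_right ?_ h0.le) (h1 t ht).1
  exact Real.cos_le_cos_of_nonneg_of_le_pi ht.1 (by linarith [hθ.2, Real.pi_pos]) ht.2

/-- The gradient estimate, integrated along the meridian from the pole. -/
theorem meridian_growth (hθ : θ ∈ Set.Ioo 0 (Real.pi / 2)) (hpos : ∀ ζ, 0 < s ζ) {A h : ℝ}
    (hA : 0 ≤ A) (h0 : 0 < h) (h1 : h < 1)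
    (hgrad : ∀ ζ : cap n θ, ‖quotientGradient s H ζ‖ ≤ A * (1 - Real.cos θ) * s ζ ^ h)
    {v : E n} (hv : ⟪eLast n, v⟫ = 0) (hv1 : ‖v‖ = 1) {t : ℝ} (ht : t ∈ Set.Icc 0 θ) :
    H (greatCircle (eLast n) v t) ^ (1 - h) ≤
      (H (eLast n) / (1 - Real.cos θ)) ^ (1 - h) + A * t := by
  have hcos := cos_pos_of_mem_Ioo hθ
  have hcos1 := cos_lt_one_of_mem_Ioo hθ
  set c : ℝ → E n := greatCircle (eLast n) v with hc
  set c' : ℝ → E n := fun t => -Real.sin t • eLast n + Real.cos t • v with hc'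
  have hmem : ∀ t ∈ Set.Icc 0 θ, c t ∈ sphericalCap n θ := fun t ht =>
    meridian_mem hθ hv hv1 (by rw [abs_of_nonneg ht.1]; exact ht.2)
  have hHpos : ∀ t ∈ Set.Icc 0 θ, 0 < H (c t) := fun t ht => by
    have := hpos (ofNormal _ (hmem t ht))
    rwa [← hH.eq, normal_ofNormal] at this
  have hl : ∀ t, 1 - Real.cos θ ≤ 1 - Real.cos θ * Real.cos t := fun t => by
    have := mul_le_of_le_one_right hcos.le (Real.cos_le_one t)
    linarith
  have hl0 : ∀ t, 0 < 1 - Real.cos θ * Real.cos t := fun t => lt_of_lt_of_le (by linarith) (hl t)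
  have hl1 : ∀ t ∈ Set.Icc 0 θ, 1 - Real.cos θ * Real.cos t ≤ 1 := fun t ht => by
    have : 0 < Real.cos t :=
      Real.cos_pos_of_mem_Ioo ⟨by linarith [ht.1, Real.pi_pos], by linarith [ht.2, hθ.2]⟩
    nlinarith
  have hle_quot : ∀ t ∈ Set.Icc 0 θ, H (c t) ≤ H (c t) / (1 - Real.cos θ * Real.cos t) :=
    fun t ht => by
      rw [le_div_iff₀ (hl0 t)]
      exact mul_le_of_le_one_right (hHpos t ht).le (hl1 t ht)
  have hd : ∀ t ∈ Set.Icc 0 θ, HasDerivAt (fun t => H (c t) / (1 - Real.cos θ * Real.cos t))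
      ((fderiv ℝ H (c t) (c' t) * (1 - Real.cos θ * Real.cos t) -
        H (c t) * (Real.cos θ * Real.sin t)) / (1 - Real.cos θ * Real.cos t) ^ 2) t := fun t _ => by
    have e1 : HasDerivAt (fun t => H (c t)) (fderiv ℝ H (c t) (c' t)) t :=
      (hH.hasFDerivAt (c t)).comp_hasDerivAt t (hasDerivAt_greatCircle _ _ t)
    have e2 : HasDerivAt (fun t => 1 - Real.cos θ * Real.cos t) (Real.cos θ * Real.sin t) t :=
      (((Real.hasDerivAt_cos t).const_mul (Real.cos θ)).const_sub 1).congr_deriv (by ring)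
    exact e1.div e2 (hl0 t).ne'
  have hbound : ∀ t ∈ Set.Icc 0 θ, (fderiv ℝ H (c t) (c' t) * (1 - Real.cos θ * Real.cos t) -
        H (c t) * (Real.cos θ * Real.sin t)) / (1 - Real.cos θ * Real.cos t) ^ 2 ≤
      A * (H (c t) / (1 - Real.cos θ * Real.cos t)) ^ h := fun t ht => by
    set ζ := ofNormal (c t) (hmem t ht) with hζ
    have hζn : normal ζ = c t := normal_ofNormal _ _
    have hls : capSupport ζ = 1 - Real.cos θ * Real.cos t := by
      rw [capSupport, hζn, hc, inner_meridian hv]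
    have hsζ : s ζ = H (c t) := by rw [← hH.eq, hζn]
    have hζc : ⟪(ζ : E n), c' t⟫ = Real.cos θ * Real.sin t := by
      rw [inner_coe, hζn]
      simp only [hc, hc', inner_greatCircle, inner_add_right, inner_smul_right, hv, norm_eLast,
        real_inner_self_eq_norm_sq, hv1, real_inner_comm (eLast n) v]
      ring
    have hc'1 : ‖c' t‖ = 1 := by
      have e1 : ‖c' t‖ ^ 2 = 1 := by
        simp only [hc']
        rw [norm_add_sq_real, norm_smul, norm_smul, inner_smul_left, inner_smul_right, hv,
          norm_eLast, hv1]
        simp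
      exact (pow_eq_one_iff_of_nonneg (norm_nonneg _) two_ne_zero).1 e1
    have e1 := inner_quotientGradient s H ζ (c' t)
    rw [hls, hsζ, hζc, hζn] at e1
    have e2 : ⟪quotientGradient s H ζ, c' t⟫ ≤ A * (1 - Real.cos θ) * H (c t) ^ h := by
      refine (real_inner_le_norm _ _).trans ?_
      rw [hc'1, mul_one, ← hsζ]
      exact hgrad ζ
    have e3 : (fderiv ℝ H (c t) (c' t) * (1 - Real.cos θ * Real.cos t) -
        H (c t) * (Real.cos θ * Real.sin t)) / (1 - Real.cos θ * Real.cos t) ^ 2 =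
        ⟪quotientGradient s H ζ, c' t⟫ / (1 - Real.cos θ * Real.cos t) := by
      rw [e1]
      have := (hl0 t).ne'
      field_simp
    rw [e3, div_le_iff₀ (hl0 t)]
    have e4 : H (c t) ^ h ≤ (H (c t) / (1 - Real.cos θ * Real.cos t)) ^ h :=
      Real.rpow_le_rpow (hHpos t ht).le (hle_quot t ht) h0.le
    have e5 : 0 ≤ H (c t) ^ h := Real.rpow_nonneg (hHpos t ht).le h
    calc ⟪quotientGradient s H ζ, c' t⟫ ≤ A * (1 - Real.cos θ) * H (c t) ^ h := e2
      _ = A * H (c t) ^ h * (1 - Real.cos θ) := by ring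
      _ ≤ A * (H (c t) / (1 - Real.cos θ * Real.cos t)) ^ h * (1 - Real.cos θ * Real.cos t) :=
        mul_le_mul (mul_le_mul_of_nonneg_left e4 hA) (hl t) (by linarith)
          (mul_nonneg hA (e5.trans e4))
  have hfin := rpow_growth hA h0 h1 hd (fun t ht => div_pos (hHpos t ht) (hl0 t)) hbound ht
  simp only [Real.cos_zero, mul_one] at hfin
  have hc0 : c 0 = eLast n := greatCircle_zero _ _
  rw [hc0] at hfin
  exact (Real.rpow_le_rpow (hHpos t ht).le (hle_quot t ht) (by linarith)).trans hfin

end IsHomogeneousExtension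

/-! ### The two-sided bound -/

theorem isCompact_cap (n : ℕ) (θ : ℝ) : IsCompact (cap n θ) := by
  refine Metric.isCompact_of_isClosed_isBounded ?_ ?_
  · have h1 : Continuous fun ζ : E n => ζ + Real.cos θ • eLast n := by fun_prop
    have h2 : IsClosed {ζ : E n | ‖ζ + Real.cos θ • eLast n‖ = 1} :=
      isClosed_eq h1.norm continuous_const
    have h3 : IsClosed {ζ : E n | Real.cos θ ≤ ⟪ζ + Real.cos θ • eLast n, eLast n⟫} :=
      isClosed_le continuous_const (h1.inner continuous_const)
    exact h2.inter h3
  · refine (Metric.isBounded_closedBall (x := -(Real.cos θ • eLast n)) (r := 1)).subset ?_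
    intro ζ hζ
    rw [Metric.mem_closedBall, dist_eq_norm, sub_neg_eq_add]
    exact hζ.1.le

theorem exists_forall_le {f : cap n θ → ℝ} (hf : Continuous f) (ζ₀ : cap n θ) :
    ∃ ζ, ∀ ξ, f ξ ≤ f ζ := by
  have : CompactSpace (cap n θ) := isCompact_iff_compactSpace.1 (isCompact_cap n θ)
  obtain ⟨ζ, -, hζ⟩ := isCompact_univ.exists_isMaxOn ⟨ζ₀, Set.mem_univ _⟩ hf.continuousOn
  exact ⟨ζ, fun ξ => hζ (Set.mem_univ ξ)⟩

theorem continuous_normal : Continuous (normal : cap n θ → E n) :=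
  continuous_subtype_val.add continuous_const

theorem IsSmooth.continuous {f : cap n θ → ℝ} (hf : IsSmooth f) : Continuous f := by
  obtain ⟨F, hF, hFf⟩ := hf
  have : f = fun ζ : cap n θ => F ζ := funext fun ζ => (hFf ζ).symm
  rw [this]
  exact hF.continuous.comp continuous_subtype_val

namespace IsHomogeneousExtension

variable {s : cap n θ → ℝ} {H : E n → ℝ} (hH : IsHomogeneousExtension s H)

include hH

theorem continuous : Continuous s := by
  have : s = fun ζ => H (normal ζ) := funext fun ζ => (hH.eq ζ).symm
  rw [this]
  exact hH.contDiff.continuous.comp continuous_normal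

theorem continuous_quotientGradient (hl : ∀ ζ : cap n θ, 0 < capSupport ζ) :
    Continuous (quotientGradient s H) := by
  have h1 : Continuous (capSupport : cap n θ → ℝ) := by
    unfold capSupport
    exact continuous_const.sub (continuous_const.mul (continuous_normal.inner continuous_const))
  unfold quotientGradient
  refine Continuous.sub ?_ ((hH.continuous.div h1 fun ζ => (hl ζ).ne').smul continuous_subtype_val)
  exact (InnerProductSpace.toDual ℝ (E n)).symm.continuous.comp
    (hH.contDiff_fderiv.continuous.comp continuous_normal)

/-- The gradient estimate `|W| ≤ C M ^ (1 - h) s ^ h` for the quotient gradient `W`, where `M`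
bounds `s` from above. -/
theorem gradient_estimate {k : ℕ} (hk : 1 ≤ k) (hkn : k ≤ n) {p : ℝ} (hp : 1 < p)
    (hθ : θ ∈ Set.Ioo 0 (Real.pi / 2)) {φ : cap n θ → ℝ} {Φ : E n → ℝ}
    (hΦ : IsSmoothExtension φ Φ) (hφ : ∀ ζ, 0 < φ ζ) {C : ℝ}
    (hC : ∀ (ζ : cap n θ) (w : E n), ‖w‖ = 1 → |fderiv ℝ Φ (ζ : E n) w| ≤ C * φ ζ)
    (hconv : IsStrictlyConvex s) (hsol : IsSolution k p φ s) (hpos : ∀ ζ, 0 < s ζ)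
    (hbd : ∀ ζ : cap n θ, IsBoundary ζ → fderiv ℝ H (normal ζ) (eLast n) = 0)
    {h r : ℝ} (h0 : 0 < h) (h1 : h < 1) (hr : 0 < r)
    (hr1 : 8 * r ≤ (1 - Real.cos θ) ^ 2 * (h * (1 - h)))
    (hr2 : r * (p - 1 + C + k) ≤ p - 1 - h * k) (hθ1 : Real.cos θ < 1)
    {M : ℝ} (hM : ∀ ζ, s ζ ≤ M) (ζ : cap n θ) :
    ‖quotientGradient s H ζ‖ ≤ M ^ (1 - h) / (r * (1 - Real.cos θ)) * s ζ ^ h := by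
  have hcos := cos_pos_of_mem_Ioo hθ
  have hδ : 0 < 1 - Real.cos θ := by linarith
  have hl : ∀ ζ : cap n θ, 0 < capSupport ζ := fun ζ => hδ.trans_le (le_capSupport hcos ζ)
  have hsh : ∀ ζ, 0 < s ζ ^ h := fun ζ => Real.rpow_pos_of_pos (hpos ζ) h
  have hcont : Continuous fun ζ => ‖quotientGradient s H ζ‖ / s ζ ^ h :=
    (hH.continuous_quotientGradient hl).norm.div
      (hH.continuous.rpow_const fun ζ => Or.inl (hpos ζ).ne') fun ζ => (hsh ζ).ne'
  obtain ⟨η, hη⟩ := exists_forall_le hcont ζ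
  have hmax : ∀ ξ : cap n θ, ‖quotientGradient s H ξ‖ * s η ^ h ≤
      ‖quotientGradient s H η‖ * s ξ ^ h := fun ξ => by
    have := hη ξ
    rwa [div_le_div_iff₀ (hsh ξ) (hsh η)] at this
  have h2 := hH.norm_quotientGradient_le_of_max hk hkn hp hθ hΦ hφ hC hconv hsol hpos hbd h0 h1 hr
    hr1 hr2 hmax
  have h3 : ‖quotientGradient s H η‖ ≤ s η / (r * (1 - Real.cos θ)) := by
    rw [le_div_iff₀ (mul_pos hr hδ)]
    have e1 : s η / capSupport η ≤ s η / (1 - Real.cos θ) :=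
      div_le_div_of_nonneg_left (hpos η).le hδ (le_capSupport hcos η)
    have e2 := h2.trans e1
    rw [le_div_iff₀ hδ] at e2
    linarith
  have h4 : s η / s η ^ h = s η ^ (1 - h) := by
    rw [Real.rpow_sub (hpos η), Real.rpow_one]
  have h5 : s η ^ (1 - h) ≤ M ^ (1 - h) := Real.rpow_le_rpow (hpos η).le (hM η) (by linarith)
  have h6 : ‖quotientGradient s H ζ‖ / s ζ ^ h ≤ M ^ (1 - h) / (r * (1 - Real.cos θ)) := by
    refine (hη ζ).trans ?_
    calc ‖quotientGradient s H η‖ / s η ^ h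
        ≤ s η / (r * (1 - Real.cos θ)) / s η ^ h := div_le_div_of_nonneg_right h3 (hsh η).le
      _ = s η ^ (1 - h) / (r * (1 - Real.cos θ)) := by rw [← h4]; ring
      _ ≤ _ := div_le_div_of_nonneg_right h5 (mul_pos hr hδ).le
  rwa [div_le_iff₀ (hsh ζ)] at h6

/-- A solution has a minimum point where it is bounded above in terms of `φ`. -/
theorem exists_min_le {k : ℕ} (hkn : k ≤ n) {p : ℝ} (hθ : θ ∈ Set.Ioo 0 (Real.pi / 2))
    {φ : cap n θ → ℝ} (hsol : IsSolution k p φ s) (hpos : ∀ ζ, 0 < s ζ)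
    (hbd : ∀ ζ : cap n θ, IsBoundary ζ → fderiv ℝ H (normal ζ) (eLast n) = 0) (ζ₀ : cap n θ) :
    ∃ ζ, s ζ ^ ((k : ℝ) - (p - 1)) ≤ φ ζ := by
  have hsin := sin_pos_of_mem_Ioo hθ
  obtain ⟨ζ, hζ⟩ := exists_forall_le hH.continuous.neg ζ₀
  have hmin : ∀ ξ, s ζ ≤ s ξ := fun ξ => neg_le_neg_iff.1 (hζ ξ)
  refine ⟨ζ, ?_⟩
  have h1 := pow_le_sigma (hH.tauSharp_isSymmetric hsin ζ) (hpos ζ).le (fun X hX => by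
    rw [hH.inner_tauSharp_eq hsin]
    exact hH.le_hess_of_min hθ hbd (hpos ζ) hmin X.2 hX) (hkn.trans_eq (finrank_tangent ζ).symm)
  rw [hsol.equation, ← Real.rpow_natCast, mul_comm] at h1
  rwa [Real.rpow_sub (hpos ζ), div_le_iff₀ (Real.rpow_pos_of_pos (hpos ζ) _)]

/-- A solution has a point where it is bounded below in terms of `φ`. -/
theorem exists_le_max {k : ℕ} {p : ℝ} (hθ : θ ∈ Set.Ioo 0 (Real.pi / 2))
    {φ : cap n θ → ℝ} (hconv : IsStrictlyConvex s) (hsol : IsSolution k p φ s)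
    (hpos : ∀ ζ, 0 < s ζ)
    (hbd : ∀ ζ : cap n θ, IsBoundary ζ → fderiv ℝ H (normal ζ) (eLast n) = 0) (ζ₀ : cap n θ) :
    ∃ ζ, φ ζ ≤ (n.choose k : ℝ) * (1 + (Real.sin θ ^ 2)⁻¹ + (Real.sin θ ^ 2)⁻¹ ^ 2) ^ k *
      s ζ ^ ((k : ℝ) - (p - 1)) := by
  have hsin := sin_pos_of_mem_Ioo hθ
  have hcont : Continuous fun ξ : cap n θ =>
      s ξ * Real.exp ((Real.sin θ ^ 2)⁻¹ * ⟪normal ξ, eLast n⟫) :=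
    hH.continuous.mul (Real.continuous_exp.comp
      (continuous_const.mul (continuous_normal.inner continuous_const)))
  obtain ⟨ζ, hζ⟩ := exists_forall_le hcont ζ₀
  refine ⟨ζ, ?_⟩
  have h1 := sigma_le_pow (hH.tauSharp_isSymmetric hsin ζ) (fun X hX => by
    refine ⟨?_, ?_⟩
    · rw [inner_tauSharp]
      exact (hconv ζ X (fun h0 => by rw [h0, norm_zero] at hX; exact zero_ne_one hX)).le
    · rw [hH.inner_tauSharp_eq hsin]
      exact hH.hess_le_of_max hθ hbd (hpos ζ) hζ X.2 hX) k
  rw [hsol.equation, finrank_tangent, mul_pow, ← Real.rpow_natCast (s ζ)] at h1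
  have h2 := Real.rpow_pos_of_pos (hpos ζ) (p - 1)
  rw [Real.rpow_sub (hpos ζ), mul_div_assoc', le_div_iff₀ h2]
  linarith

/-- A Harnack inequality: the value at the pole is at least a multiple of the value at `ζ`, if the
gradient estimate holds with `s ζ` as the upper bound for `s`. Along the meridian through `ζ` the
quotient `s / sin` decreases, so that `s` grows at least linearly away from the pole; by the
gradient estimate, with a positive power of `s` on its right-hand side, a small value at the pole would force
a growth slower than linear. -/
theorem le_mul_of_growth (hn : 1 ≤ n) (hθ : θ ∈ Set.Ioo 0 (Real.pi / 2))
    (hconv : IsStrictlyConvex s) (heven : IsEven s)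
    (hbd : ∀ ζ : cap n θ, IsBoundary ζ → fderiv ℝ H (normal ζ) (eLast n) = 0)
    (hpos : ∀ ζ, 0 < s ζ) (hθ1 : Real.cos θ < 1) {A h : ℝ} (hA : 0 < A) (h0 : 0 < h) (h1 : h < 1)
    {ζ : cap n θ}
    (hgrad : ∀ ξ : cap n θ, ‖quotientGradient s H ξ‖ ≤
      A * s ζ ^ (1 - h) * (1 - Real.cos θ) * s ξ ^ h)
    {t ε : ℝ} (ht : t ∈ Set.Icc 0 θ)
    (hε : ∀ x, 0 ≤ x → (Real.cos θ * Real.sin t) ^ (1 - h) ≤ x ^ (1 - h) + A * t → ε ≤ x) :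
    ε * (1 - Real.cos θ) * s ζ ≤ H (eLast n) := by
  have hcos := cos_pos_of_mem_Ioo hθ
  have hδ : 0 < 1 - Real.cos θ := by linarith
  obtain ⟨v, hv1, hv, τ, hτ, hsτ⟩ := hH.eq_meridian hn hθ ζ
  obtain ⟨hp0, hp⟩ := hH.meridian_bounds hθ hconv heven hbd hv hv1
  have hMpos := hpos ζ
  set M := s ζ with hMdef
  have hsint : 0 ≤ Real.sin t :=
    Real.sin_nonneg_of_nonneg_of_le_pi ht.1 (by linarith [ht.2, hθ.2, Real.pi_pos])
  -- The boundary value on the meridian through the maximum point is comparable to the maximum.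
  have e1 : Real.cos θ * M ≤ H (greatCircle (eLast n) v θ) := by
    have e2 := (hp τ hτ).2.1
    have e3 : 0 < H (greatCircle (eLast n) v θ) := by
      have e4 : 0 < Real.cos θ * H (eLast n) := mul_pos hcos hp0
      exact e4.trans_le (hp θ ⟨hθ.1.le, le_rfl⟩).1
    rw [← hsτ] at e2
    exact e2.trans (mul_le_of_le_one_left e3.le (Real.cos_le_one τ))
  have e2 : Real.cos θ * Real.sin t * M ≤ H (greatCircle (eLast n) v t) := by
    have e3 := (hp t ht).2.2
    have e4 : 0 < H (greatCircle (eLast n) v t) := by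
      have hct : 0 < Real.cos t :=
        Real.cos_pos_of_mem_Ioo ⟨by linarith [ht.1, Real.pi_pos], by linarith [ht.2, hθ.2]⟩
      exact (mul_pos hct hp0).trans_le (hp t ht).1
    have e5 : Real.sin t * (Real.cos θ * M) ≤ Real.sin t * H (greatCircle (eLast n) v θ) :=
      mul_le_mul_of_nonneg_left e1 hsint
    have e6 : Real.sin θ * H (greatCircle (eLast n) v t) ≤ H (greatCircle (eLast n) v t) :=
      mul_le_of_le_one_left e4.le (Real.sin_le_one θ)
    linarith
  have hM1 : 0 < M ^ (1 - h) := Real.rpow_pos_of_pos hMpos _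
  have e3 := hH.meridian_growth hθ hpos (mul_pos hA hM1).le h0 h1 hgrad hv hv1 ht
  have hcs : 0 ≤ Real.cos θ * Real.sin t := mul_nonneg hcos.le hsint
  have e4 : (Real.cos θ * Real.sin t) ^ (1 - h) * M ^ (1 - h) ≤
      (H (eLast n) / (1 - Real.cos θ)) ^ (1 - h) + A * M ^ (1 - h) * t := by
    rw [← Real.mul_rpow hcs hMpos.le]
    exact (Real.rpow_le_rpow (mul_nonneg hcs hMpos.le) e2 (by linarith)).trans e3
  have hx : 0 ≤ H (eLast n) / (1 - Real.cos θ) := (div_pos hp0 hδ).le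
  have e5 := hε (H (eLast n) / (1 - Real.cos θ) / M) (div_nonneg hx hMpos.le) (by
    rw [Real.div_rpow hx hMpos.le, ← sub_le_iff_le_add, le_div_iff₀ hM1]
    linarith)
  rw [le_div_iff₀ hMpos, le_div_iff₀ hδ] at e5
  linarith

end IsHomogeneousExtension

end Capillary

open Capillary in
theorem theorem3p3 (n k : ℕ) (hk : 1 ≤ k) (hkn : k ≤ n) (p θ γ : ℝ)
    (hp : 1 < p) (hpk : p < (k : ℝ) + 1)
    (hθ : θ ∈ Set.Ioo 0 (Real.pi / 2))
    (hγ : 0 < γ) (hγ' : γ < 2 * (p - 1) / (k : ℝ))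
    (φ : Capillary.cap n θ → ℝ) (hφ : Capillary.IsSmooth φ) (hφpos : ∀ ζ, 0 < φ ζ) :
    ∃ C₁ : ℝ, 0 < C₁ ∧ ∀ s : Capillary.cap n θ → ℝ,
      Capillary.IsEven s → Capillary.IsStrictlyConvex s → Capillary.IsSolution k p φ s →
        ∀ ζ, C₁⁻¹ ≤ s ζ ∧ s ζ ≤ C₁ := by
  have hsin := sin_pos_of_mem_Ioo hθ
  have hcos := cos_pos_of_mem_Ioo hθ
  have hcos1 := cos_lt_one_of_mem_Ioo hθ
  have hδ : 0 < 1 - Real.cos θ := by linarith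
  have hn : 1 ≤ n := hk.trans hkn
  have hkR : (0 : ℝ) < k := by exact_mod_cast hk
  have hpole : eLast n ∈ sphericalCap n θ := ⟨norm_eLast, by rw [inner_eLast_self]; exact hcos1.le⟩
  set ζ₀ : cap n θ := ofNormal _ hpole
  -- Bounds for `φ` and its gradient.
  obtain ⟨Φ, hΦ⟩ := hφ
  have hφc : Continuous φ := IsSmooth.continuous ⟨Φ, hΦ⟩
  obtain ⟨ζa, hζa⟩ := exists_forall_le hφc.neg ζ₀
  obtain ⟨ζb, hζb⟩ := exists_forall_le hφc ζ₀
  have hφa : ∀ ζ, φ ζa ≤ φ ζ := fun ζ => neg_le_neg_iff.1 (hζa ζ)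
  have hΦc : Continuous fun ζ : cap n θ => ‖fderiv ℝ Φ (ζ : E n)‖ / φ ζ :=
    ((hΦ.1.continuous_fderiv (by simp)).comp continuous_subtype_val).norm.div hφc
      fun ζ => (hφpos ζ).ne'
  obtain ⟨ζc, hζc⟩ := exists_forall_le hΦc ζ₀
  set C := ‖fderiv ℝ Φ (ζc : E n)‖ / φ ζc with hCdef
  have hC0 : 0 ≤ C := div_nonneg (norm_nonneg _) (hφpos ζc).le
  have hC : ∀ (ζ : cap n θ) (w : E n), ‖w‖ = 1 → |fderiv ℝ Φ (ζ : E n) w| ≤ C * φ ζ :=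
    fun ζ w hw => by
      have e1 := (fderiv ℝ Φ (ζ : E n)).le_opNorm w
      rw [hw, mul_one, Real.norm_eq_abs] at e1
      exact e1.trans ((div_le_iff₀ (hφpos ζ)).1 (hζc ζ))
  -- The exponent in the gradient estimate; it may be decreased to make it less than one.
  set h := min (γ / 2) (1 / 2) with hhdef
  have h0 : 0 < h := lt_min (by linarith) (by norm_num)
  have h1 : h < 1 := (min_le_right _ _).trans_lt (by norm_num)
  have hhk : 0 < p - 1 - h * k := by
    rw [lt_div_iff₀ hkR] at hγ'
    have : h * k ≤ γ / 2 * k := mul_le_mul_of_nonneg_right (min_le_left _ _) hkR.le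
    linarith
  set r := min ((1 - Real.cos θ) ^ 2 * (h * (1 - h)) / 8) ((p - 1 - h * k) / (p - 1 + C + k))
    with hrdef
  have hden : 0 < p - 1 + C + k := by linarith
  have hr : 0 < r := lt_min (by have : 0 < 1 - h := by linarith
                                positivity) (div_pos hhk hden)
  have hr1 : 8 * r ≤ (1 - Real.cos θ) ^ 2 * (h * (1 - h)) := by
    have : r ≤ (1 - Real.cos θ) ^ 2 * (h * (1 - h)) / 8 := min_le_left _ _
    linarith
  have hr2 : r * (p - 1 + C + k) ≤ p - 1 - h * k := (le_div_iff₀ hden).1 (min_le_right _ _)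
  set A := 1 / (r * (1 - Real.cos θ) ^ 2) with hAdef
  have hA : 0 < A := by positivity
  obtain ⟨t, ht, ε, hεpos, hε⟩ := exists_lower_bound hθ (A := A) h0 h1 hcos
  -- Bounds for the extrema.
  set m := (k : ℝ) - (p - 1) with hmdef
  have hm : 0 < m := by linarith
  set N := (n.choose k : ℝ) * (1 + (Real.sin θ ^ 2)⁻¹ + (Real.sin θ ^ 2)⁻¹ ^ 2) ^ k with hNdef
  have hN : 0 < N := by
    have : (0 : ℝ) < n.choose k := by exact_mod_cast Nat.choose_pos hkn
    positivity
  set a := (φ ζa / N) ^ m⁻¹ with hadef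
  have ha : 0 < a := Real.rpow_pos_of_pos (div_pos (hφpos ζa) hN) _
  set b := φ ζb ^ m⁻¹ with hbdef
  have hb : 0 < b := Real.rpow_pos_of_pos (hφpos ζb) _
  set κ := Real.cos θ * (ε * (1 - Real.cos θ)) with hκdef
  have hκ : 0 < κ := by positivity
  refine ⟨max (κ * a)⁻¹ (b / κ), lt_max_of_lt_right (div_pos hb hκ), ?_⟩
  intro s heven hconv hsol
  obtain ⟨H, hH⟩ := exists_homogeneousExtension hsol.smooth
  have hbd : ∀ ζ : cap n θ, IsBoundary ζ → fderiv ℝ H (normal ζ) (eLast n) = 0 := fun ζ hζ =>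
    hH.fderiv_eLast_eq_zero hsin hζ (hsol.boundary ζ hζ)
  have hpole_le := hH.cos_mul_pole_le hn hθ hconv heven hbd
  have hpos : ∀ ζ, 0 < s ζ := fun ζ =>
    (mul_pos hcos (hpole_le ζ).1).trans_le (hpole_le ζ).2
  obtain ⟨ζM, hζM⟩ := exists_forall_le hH.continuous ζ₀
  have hharnack := hH.le_mul_of_growth hn hθ hconv heven hbd hpos hcos1 hA h0 h1
    (fun ξ => (hH.gradient_estimate hk hkn hp hθ hΦ hφpos hC hconv hsol hpos hbd h0 h1 hr hr1 hr2
      hcos1 hζM ξ).trans_eq (by rw [hAdef]; field_simp)) ht hε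
  -- The minimum is at least a fixed multiple of the maximum.
  have hmin : ∀ ζ, κ * s ζM ≤ s ζ := fun ζ => by
    have e1 := mul_le_mul_of_nonneg_left hharnack hcos.le
    have e2 := (hpole_le ζ).2
    rw [hκdef]
    linarith
  obtain ⟨ζ₁, hζ₁⟩ := hH.exists_min_le hkn hθ hsol hpos hbd ζ₀
  obtain ⟨ζ₂, hζ₂⟩ := hH.exists_le_max hθ hconv hsol hpos hbd ζ₀
  have hle1 : s ζ₁ ≤ b := by
    calc s ζ₁ = (s ζ₁ ^ m) ^ m⁻¹ := (Real.rpow_rpow_inv (hpos ζ₁).le hm.ne').symm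
      _ ≤ b := Real.rpow_le_rpow (Real.rpow_nonneg (hpos ζ₁).le _) (hζ₁.trans (hζb ζ₁))
        (inv_nonneg.2 hm.le)
  have hle2 : a ≤ s ζ₂ := by
    calc a ≤ (s ζ₂ ^ m) ^ m⁻¹ := by
          refine Real.rpow_le_rpow (div_pos (hφpos ζa) hN).le ?_ (inv_nonneg.2 hm.le)
          rw [div_le_iff₀ hN]
          linarith [hφa ζ₂]
      _ = s ζ₂ := Real.rpow_rpow_inv (hpos ζ₂).le hm.ne'
  intro ζ
  constructor
  · have e1 : κ * a ≤ s ζ :=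
      (mul_le_mul_of_nonneg_left (hle2.trans (hζM ζ₂)) hκ.le).trans (hmin ζ)
    refine le_trans ?_ e1
    exact inv_le_of_inv_le₀ (mul_pos hκ ha) (le_max_left _ _)
  · refine le_trans ?_ (le_max_right _ _)
    rw [le_div_iff₀ hκ]
    have e1 := mul_le_mul_of_nonneg_left (hζM ζ) hκ.le
    linarith [hmin ζ₁]

end
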